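/- **Noiseless coding theorem for hybrid memories.** *Setting.* A memory is a finite-dimensional $*$-algebra $\mathcal{A}=\bigoplus_{k=1}^n \mathcal{M}_{\lambda_k}$, a direct sum of complex matrix algebras. An element is positive if it has the form $A^*A$, and $X\ge Y$ means that $X-Y$ is positive. A state on $\mathcal{A}$ is a linear functional $\rho:\mathcal{A}\to\mathbb{C}$ that is nonnegative on positive elements and has $\rho(1)=1$. Let $r_{k,j}$ ($1\le j\le\lambda_k$) be the eigenvalues of the density matrix of $\rho|_{\mathcal{M}_{\lambda_k}}$, and let $r_k=\sum_j r_{k,j}$. The classical and the quantum entropy of $\rho$ are $$H_{\mathcal{A}}(\rho)=-\sum_k r_k\log r_k,\qquad S_{\mathcal{A}}(\rho)=-\sum_{k,j} r_{k,j}\log\frac{r_{k,j}}{r_k}$$ (with zero terms omitted). The capacity region of a memory $\mathcal{B}$ is $$C(\mathcal{B})=\{(H_{\mathcal{B}}(\sigma)+t,\;S_{\mathcal{B}}(\sigma)-t)\;:\;\sigma\text{ a state on }\mathcal{B},\ 0\le t\le S_{\mathcal{B}}(\sigma)\}\subset\mathbb{R}^2 .$$ A decay quantum operation $\mathcal{E}:\mathcal{A}\to\mathcal{B}$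 is a linear map that is completely positive ($\mathrm{id}_{\mathcal{C}}\otimes\mathcal{E}$ preserves positivity for every memory $\mathcal{C}$) and subunital ($\mathcal{E}(1)\le 1$). For linear functionals put $D(\varphi,\psi)=\sup_{0\le P\le 1}|\varphi(P)-\psi(P)|$; for two states this is the trace distance. The complete fidelity of a decay operation $\mathcal{E}:\mathcal{A}\to\mathcal{A}$ at a state $\rho$ is $$F(\rho,\mathcal{E})=\inf_{\mathcal{C}}\ \inf_{\sigma}\ \bigl(1-D(\sigma,\ \sigma\circ(\mathrm{id}_{\mathcal{C}}\otimes\mathcal{E}))\bigr),$$ over all nonzero memories $\mathcal{C}$ and all states $\sigma$ on $\mathcal{C}\otimes\mathcal{A}$ with $\sigma(1\otimes a)=\rho(a)$ for all $a\in\mathcal{A}$. *Theorem.* Let $\mathcal{A}$ and $\mathcal{B}$ be memories and let $\rho$ be a state on $\mathcal{A}$. 1. The following are equivalent: * For every rational $\epsilon>0$ there is a reliable noiseless coding sequence: decay quantum operations $$\mathcal{A}^{\otimes N}\xrightarrow{\ \mathcal{Y}_N\ }\mathcal{B}^{\otimes N(1+\epsilon)}\xrightarrow{\ \mathcal{X}_N\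 }\mathcal{A}^{\otimes N},$$ one pair for each $N$ such that $N(1+\epsilon)$ is an integer, with $F(\rho^{\otimes N},\mathcal{X}_N\circ\mathcal{Y}_N)\to 1$ as $N\to\infty$ through these $N$. * $(H_{\mathcal{A}}(\rho),S_{\mathcal{A}}(\rho))\in C(\mathcal{B})$. 2. If $(H_{\mathcal{A}}(\rho),S_{\mathcal{A}}(\rho))\notin C(\mathcal{B})$, then for all small $\epsilon$ the fidelity of any coding decays exponentially: there are a rational $\epsilon_0>0$ and real constants $K$ and $c>0$ such that for every rational $0<\epsilon\le\epsilon_0$, every $N$ with $N(1+\epsilon)$ an integer, and all decay quantum operations $\mathcal{Y}:\mathcal{A}^{\otimes N}\to\mathcal{B}^{\otimes N(1+\epsilon)}$ and $\mathcal{X}:\mathcal{B}^{\otimes N(1+\epsilon)}\to\mathcal{A}^{\otimes N}$, $$F(\rho^{\otimes N},\mathcal{X}\circ\mathcal{Y})\le K e^{-cN}.$$ -/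

import Mathlib

open scoped ComplexOrder Kronecker
open Filter Topology

/-- A (finite, hybrid quantum) memory `⨁ k, M_{λ k}`: a finite set of blocks, and for each block `k`
a finite set `Blk k` (with `λ k` elements) that labels the rows and columns of its matrices. -/
structure Memory : Type 1 where
  Idx : Type
  Blk : Idx → Type
  [fintypeIdx : Fintype Idx]
  [decEqIdx : DecidableEq Idx]
  [fintypeBlk : ∀ k, Fintype (Blk k)]
  [decEqBlk : ∀ k, DecidableEq (Blk k)]

namespace Memory

attribute [instance] Memory.fintypeIdx Memory.decEqIdx Memory.fintypeBlk Memory.decEqBlk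

/-- The `*`-algebra of a memory, a direct sum of full complex matrix algebras. -/
abbrev Alg (A : Memory) : Type := ∀ k : A.Idx, Matrix (A.Blk k) (A.Blk k) ℂ

/-- The tensor product of two memories; its blocks are the tensor products of blocks. -/
@[reducible] def tensor (C A : Memory) : Memory where
  Idx := C.Idx × A.Idx
  Blk := fun k => C.Blk k.1 × A.Blk k.2

/-- The tensor power `A^{⊗N}`; its blocks are labelled by words `K` of length `N` of blocks of `A`,
the basis vectors of the block `K` by words of basis vectors. -/
@[reducible] def pow (A : Memory) (N : ℕ) : Memory where
  Idx := Fin N → A.Idx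
  Blk := fun K => ∀ l : Fin N, A.Blk (K l)

/-- The elementary tensor `c ⊗ a`. -/
def tmul {C A : Memory} (c : C.Alg) (a : A.Alg) : (C.tensor A).Alg :=
  fun k => c k.1 ⊗ₖ a k.2

/-- The matrix unit `E_{i,j}` in the block `k`. -/
def unit (A : Memory) (k : A.Idx) (i j : A.Blk k) : A.Alg :=
  Pi.single k (Matrix.single i j 1)

/-- Positive elements of the algebra: those of the form `b* b`. -/
def IsPos {A : Memory} (a : A.Alg) : Prop := ∃ b : A.Alg, a = star b * b

/-- The map `id_C ⊗ E` from `C ⊗ A` to `C ⊗ B`, for a linear map `E` from `A` to `B`: the map `E` is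
applied to each `C`-matrix entry of an element of `C ⊗ A`. -/
def idTensor (C : Memory) {A B : Memory} (E : A.Alg →ₗ[ℂ] B.Alg) :
    (C.tensor A).Alg →ₗ[ℂ] (C.tensor B).Alg where
  toFun X := fun k => Matrix.of fun u v =>
    E (fun a => Matrix.of fun x y => X (k.1, a) (u.1, x) (v.1, y)) k.2 u.2 v.2
  map_add' X Y := by
    funext k
    ext u v
    exact congrFun (congrFun (congrFun (E.map_add
      (fun a => Matrix.of fun x y => X (k.1, a) (u.1, x) (v.1, y))
      (fun a => Matrix.of fun x y => Y (k.1, a) (u.1, x) (v.1, y))) k.2) u.2) v.2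
  map_smul' z X := by
    funext k
    ext u v
    exact congrFun (congrFun (congrFun (E.map_smul z
      (fun a => Matrix.of fun x y => X (k.1, a) (u.1, x) (v.1, y))) k.2) u.2) v.2

/-- Complete positivity: positive elements stay positive after tensoring with the identity of any
memory. -/
def IsCP {A B : Memory} (E : A.Alg →ₗ[ℂ] B.Alg) : Prop :=
  ∀ (C : Memory) (X : (C.tensor A).Alg), IsPos X → IsPos (idTensor C E X)

/-- Decay quantum operations: completely positive maps `E` with `E(1) ≤ 1` (subunital). -/
def IsDecayOp {A B : Memory} (E : A.Alg →ₗ[ℂ] B.Alg) : Prop :=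
  IsCP E ∧ IsPos (1 - E 1)

/-- A state: a dual vector, nonnegative on positive elements, with value `1` at the identity. -/
structure State (A : Memory) where
  toFun : A.Alg →ₗ[ℂ] ℂ
  nonneg : ∀ a : A.Alg, IsPos a → 0 ≤ toFun a
  map_one : toFun 1 = 1

namespace State

variable {A : Memory}

/-- The density matrix of the restriction of the state to the block `k`. -/
def density (ρ : A.State) (k : A.Idx) : Matrix (A.Blk k) (A.Blk k) ℂ :=
  Matrix.of fun i j => ρ.toFun (A.unit k j i)

theorem map_star (ρ : A.State) (a : A.Alg) : ρ.toFun (star a) = star (ρ.toFun a) := by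
  have h0 := (Complex.nonneg_iff.1 (ρ.nonneg _ ⟨a, rfl⟩)).2
  have h1 := (Complex.nonneg_iff.1 (ρ.nonneg _ ⟨1 + a, rfl⟩)).2
  have h2 := (Complex.nonneg_iff.1 (ρ.nonneg _ ⟨1 + Complex.I • a, rfl⟩)).2
  have e1 : star (1 + a) * (1 + a) = 1 + a + star a + star a * a := by
    rw [star_add, star_one]; noncomm_ring
  have e2 : star (1 + Complex.I • a) * (1 + Complex.I • a)
      = 1 + Complex.I • a - Complex.I • star a + star a * a := by
    rw [star_add, star_one, star_smul, add_mul, mul_add, mul_add, one_mul, one_mul, mul_one,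
      smul_mul_smul_comm]
    simp [sub_eq_add_neg, add_assoc]
  rw [e1] at h1
  rw [e2] at h2
  simp only [map_add, map_sub, map_smul, ρ.map_one, Complex.add_im, Complex.sub_im,
    Complex.one_im, smul_eq_mul, Complex.mul_im, Complex.I_re, Complex.I_im] at h1 h2
  apply Complex.ext
  · simp only [RCLike.star_def, Complex.conj_re]; linarith
  · simp only [RCLike.star_def, Complex.conj_im]; linarith

theorem density_isHermitian (ρ : A.State) (k : A.Idx) : (ρ.density k).IsHermitian := by
  ext i j
  have h : star (A.unit k i j) = A.unit k j i := by
    funext l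
    by_cases hl : l = k
    · subst hl
      simp [Memory.unit, Matrix.star_eq_conjTranspose]
    · simp [Memory.unit, hl]
  simp only [density, Matrix.conjTranspose_apply, Matrix.of_apply]
  rw [← ρ.map_star, h]

/-- The numbers `r_{k,j}`: the diagonal entries of the diagonalized state. -/
noncomputable def eigenvalue (ρ : A.State) (k : A.Idx) (j : A.Blk k) : ℝ :=
  (ρ.density_isHermitian k).eigenvalues j

/-- The number `r_k`: the total density in the block `k`. -/
noncomputable def weight (ρ : A.State) (k : A.Idx) : ℝ := ∑ j, ρ.eigenvalue k j

/-- The classical entropy of a state. -/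
noncomputable def classicalEntropy (ρ : A.State) : ℝ :=
  -∑ k, ρ.weight k * Real.log (ρ.weight k)

/-- The quantum entropy of a state. -/
noncomputable def quantumEntropy (ρ : A.State) : ℝ :=
  -∑ k, ∑ j, ρ.eigenvalue k j * Real.log (ρ.eigenvalue k j / ρ.weight k)

/-- The dual vector `ρ^{⊗N}` on `A^{⊗N}`, given by its values
`∏ l, ρ(E_{K l, J l, J' l})` on the matrix units `E_{K, J, J'}`. -/
noncomputable def pow (ρ : A.State) (N : ℕ) : (A.pow N).Alg →ₗ[ℂ] ℂ where
  toFun X := ∑ K : Fin N → A.Idx, ∑ J : (∀ l, A.Blk (K l)), ∑ J' : (∀ l, A.Blk (K l)),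
    X K J J' * ∏ l, ρ.toFun (A.unit (K l) (J l) (J' l))
  map_add' X Y := by
    simp only [Pi.add_apply, Matrix.add_apply, add_mul, Finset.sum_add_distrib]
  map_smul' z X := by
    simp only [Pi.smul_apply, Matrix.smul_apply, smul_eq_mul, mul_assoc, Finset.mul_sum,
      RingHom.id_apply]

end State

/-- The capacity region `C(B)` in the plane of classical and quantum entropy. -/
def capacityRegion (B : Memory) : Set (ℝ × ℝ) :=
  {x | ∃ (σ : B.State) (t : ℝ), 0 ≤ t ∧ t ≤ σ.quantumEntropy ∧
    x = (σ.classicalEntropy + t, σ.quantumEntropy - t)}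

/-- The trace distance of two dual vectors: the largest difference between the probabilities that they
give to an event `0 ≤ P ≤ 1`. For two states this is half of the trace norm of the difference. If one
of the two is subnormalized, then its missing probability counts as a discrepancy. -/
noncomputable def traceDist {A : Memory} (φ ψ : A.Alg →ₗ[ℂ] ℂ) : ℝ :=
  sSup {x : ℝ | ∃ P : A.Alg, IsPos P ∧ IsPos (1 - P) ∧ x = ‖φ P - ψ P‖}

/-- The `C`-fidelity of the map `E` at `ρ`: the infimum of `1 - D(σ, (id_C ⊗ E)^T σ)` over the states
`σ` on `C ⊗ A` that project to `ρ` on `A`. -/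
noncomputable def fidelityWith (C : Memory) {A : Memory} (ρ : A.Alg →ₗ[ℂ] ℂ)
    (E : A.Alg →ₗ[ℂ] A.Alg) : ℝ :=
  sInf {x : ℝ | ∃ σ : (C.tensor A).State, (∀ a : A.Alg, σ.toFun (tmul 1 a) = ρ a) ∧
    x = 1 - traceDist σ.toFun (σ.toFun ∘ₗ idTensor C E)}

/-- The complete fidelity: the infimum of the `C`-fidelity over all (nonzero) memories `C`. -/
noncomputable def completeFidelity {A : Memory} (ρ : A.Alg →ₗ[ℂ] ℂ)
    (E : A.Alg →ₗ[ℂ] A.Alg) : ℝ :=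
  sInf {x : ℝ | ∃ C : Memory, Nontrivial C.Alg ∧ x = fidelityWith C ρ E}

/-- The number `N(1+ε)`, for those `N` for which it is an integer. -/
def codeLength (ε : ℚ) (N : ℕ) : ℕ := ⌊(N : ℚ) * (1 + ε)⌋₊

/-- The `N` for which `N(1+ε)` is a nonnegative integer, so that `B^{⊗N(1+ε)}` makes sense. -/
def lengths (ε : ℚ) : Set ℕ := {N | (codeLength ε N : ℚ) = (N : ℚ) * (1 + ε)}

/-- There is a reliable noiseless coding sequence for `ρ` through `B` at the excess rate `ε`:
decay operations `Y_N` from `A^{⊗N}` to `B^{⊗N(1+ε)}` and `X_N` back, for all `N` for which `N(1+ε)` is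
an integer, such that the complete fidelity of `X_N ∘ Y_N` at `ρ^{⊗N}` tends to `1`. -/
def HasReliableCoding {A : Memory} (ρ : A.State) (B : Memory) (ε : ℚ) : Prop :=
  ∃ (Y : ∀ N : ℕ, (A.pow N).Alg →ₗ[ℂ] (B.pow (codeLength ε N)).Alg)
    (X : ∀ N : ℕ, (B.pow (codeLength ε N)).Alg →ₗ[ℂ] (A.pow N).Alg),
    (∀ N ∈ lengths ε, IsDecayOp (Y N) ∧ IsDecayOp (X N)) ∧
    Tendsto (fun N => completeFidelity (ρ.pow N) (X N ∘ₗ Y N)) (atTop ⊓ 𝓟 (lengths ε)) (𝓝 1)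

end Memory

/-! Maps act on observables, so on states `X` encodes and `Y` decodes. Write H, S for the entropies
of ρ, M = N(1+ε), and μ_k for the block dimensions of B. The eigenvectors of ρ^{⊗N} are pairs (K, J)
of words with product probabilities; by independence, the typical ones lie in about e^{NH} blocks,
with about e^{NS} of them in each.

Direct part. Let (H, S) = (H_σ + t, S_σ − t). The memory B^{⊗M} has about e^{M H_σ} blocks of
dimension at least about e^{M S_σ} (`State.eventually_exists_large_blocks`). As S_σ ≥ S, each of
them can be cut into slots of dimension about e^{NS}; as H_σ + S_σ = H + S, the excess length M > N
makes the slots numerous enough for all typical blocks of ρ^{⊗N} (`State.eventually_card_le`).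
Sending each typical block into its own slot gives a code for which `X ∘ Y` is the compression a ↦
PaP to the typical eigenvectors (`exists_packing`, `SpectralForm.exists_code`). By Cauchy–Schwarz a
compression of almost full probability is harmless, uniformly in the reference memory
(`State.norm_sub_compression_le`).

Strong converse. Purify ρ^{⊗N} and test with a rank-one operator in each diagonal block, built from
the typical eigenvectors. The purification nearly always passes the test. After coding, storage
blocks of dimension at most κe^{NS} contribute at most κ, and the larger ones about e^{−N(H+S)}
times their total dimension (`SpectralForm.completeFidelity_le_of_typical`). By Markov's inequality
for the s-th power, that total is at most about (∑ μ_k^s)^M / e^{NS(s−1)} (`sum_large_card_le`).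
Hence the fidelity decays exponentially as soon as log ∑ μ_k^s < H + sS for some s ≥ 1.

Such an s exists outside the capacity region by Legendre duality (`exists_weights`,
`mem_capacityRegion_of_forall_le`): a point of the quadrant with x + sy ≤ log ∑ μ_k^s for all s ≥ 1
is dominated by a distribution on blocks with Gibbs weights proportional to μ_k^s, or by their limit
as s → ∞; a continuity argument then lowers the total entropy to exactly x + y. -/

/-! ### Positive elements, completely positive maps, Kraus form. -/

open Matrix in
theorem Matrix.PosSemidef.exists_eq_conjTranspose_mul_self {n : Type*} [Fintype n] [DecidableEq n]
    {a : Matrix n n ℂ} (ha : a.PosSemidef) : ∃ b : Matrix n n ℂ, a = bᴴ * b := by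
  open scoped MatrixOrder in
  obtain ⟨b, hb⟩ := CStarAlgebra.nonneg_iff_eq_star_mul_self.1 (Matrix.nonneg_iff_posSemidef.2 ha)
  exact ⟨b, by rw [hb, Matrix.star_eq_conjTranspose]⟩

open Matrix in
-- Each eigenvalue is at most the sum of all of them. In the converse this replaces a stored test by
-- a scalar in each block.
theorem Matrix.PosSemidef.trace_smul_one_sub {n : Type*} [Fintype n] [DecidableEq n]
    {a : Matrix n n ℂ} (ha : a.PosSemidef) : (a.trace • (1 : Matrix n n ℂ) - a).PosSemidef := by
  set u := ha.1.eigenvectorUnitary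
  have hu : (u : Matrix n n ℂ) * (u : Matrix n n ℂ)ᴴ = 1 := by
    rw [← Matrix.star_eq_conjTranspose]; exact Unitary.coe_mul_star_self u
  have h : a.trace • (1 : Matrix n n ℂ) - a = (u : Matrix n n ℂ) *
      diagonal (fun i => a.trace - (ha.1.eigenvalues i : ℂ)) * (u : Matrix n n ℂ)ᴴ := by
    have hd : diagonal (fun i => a.trace - (ha.1.eigenvalues i : ℂ))
        = a.trace • (1 : Matrix n n ℂ) - diagonal (RCLike.ofReal ∘ ha.1.eigenvalues) := by
      ext i j
      by_cases hij : i = j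
      · subst hij; simp
      · simp [hij]
    rw [hd, mul_sub, sub_mul, Matrix.mul_smul, mul_one, Matrix.smul_mul, hu]
    congr 1
    conv_lhs => rw [ha.1.spectral_theorem]
    rw [Unitary.conjStarAlgAut_apply, Matrix.star_eq_conjTranspose]
  rw [h]
  refine (PosSemidef.diagonal fun i => ?_).mul_mul_conjTranspose_same _
  rw [Pi.zero_apply, ha.1.trace_eq_sum_eigenvalues, sub_nonneg]
  exact Finset.single_le_sum (f := fun i => (ha.1.eigenvalues i : ℂ))
    (fun i _ => by exact_mod_cast ha.eigenvalues_nonneg i) (Finset.mem_univ i)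

namespace Memory

variable {A B C : Memory}

theorem isPos_iff {a : A.Alg} : IsPos a ↔ ∀ k, (a k).PosSemidef := by
  constructor
  · rintro ⟨b, rfl⟩ k
    exact Matrix.posSemidef_conjTranspose_mul_self (b k)
  · intro h
    choose b hb using fun k => (h k).exists_eq_conjTranspose_mul_self
    exact ⟨b, funext hb⟩

theorem IsPos.zero : IsPos (0 : A.Alg) := isPos_iff.2 fun _ => Matrix.PosSemidef.zero

theorem IsPos.one : IsPos (1 : A.Alg) := isPos_iff.2 fun _ => Matrix.PosSemidef.one

theorem IsPos.add {a b : A.Alg} (ha : IsPos a) (hb : IsPos b) : IsPos (a + b) :=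
  isPos_iff.2 fun k => (isPos_iff.1 ha k).add (isPos_iff.1 hb k)

theorem IsPos.star_mul_mul {a : A.Alg} (ha : IsPos a) (b : A.Alg) : IsPos (star b * a * b) :=
  isPos_iff.2 fun k => (isPos_iff.1 ha k).conjTranspose_mul_mul_same (b k)

theorem IsPos.star_eq {a : A.Alg} (ha : IsPos a) : star a = a :=
  funext fun k => (isPos_iff.1 ha k).1

/-- For self-adjoint a, a − a² = a(1 − a)a + (1 − a)a(1 − a). -/
theorem IsPos.mul_self_le {a : A.Alg} (ha : IsPos a) (ha' : IsPos (1 - a)) :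
    IsPos (a - star a * a) := by
  have h := (ha'.star_mul_mul a).add (ha.star_mul_mul (1 - a))
  rw [ha'.star_eq, ha.star_eq] at h
  rw [ha.star_eq]
  convert h using 1
  noncomm_ring

theorem idTensor_comp {D : Memory} (E : A.Alg →ₗ[ℂ] B.Alg) (G : B.Alg →ₗ[ℂ] D.Alg)
    (X : (C.tensor A).Alg) : idTensor C (G ∘ₗ E) X = idTensor C G (idTensor C E X) := rfl

theorem idTensor_one (E : A.Alg →ₗ[ℂ] A.Alg) (a : A.Alg) :
    idTensor C E (tmul 1 a) = tmul 1 (E a) := by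
  funext k
  ext u v
  change E (fun b => Matrix.of fun x y => ((1 : C.Alg) k.1 ⊗ₖ a b) (u.1, x) (v.1, y)) k.2 u.2 v.2 = _
  have : (fun b => Matrix.of fun x y => ((1 : C.Alg) k.1 ⊗ₖ a b) (u.1, x) (v.1, y) : A.Alg)
      = ((1 : Matrix (C.Blk k.1) (C.Blk k.1) ℂ) u.1 v.1) • a := by
    funext b; ext x y; simp
  rw [this, map_smul]
  simp [tmul]

theorem tmul_one_one : (tmul 1 1 : (C.tensor A).Alg) = 1 := by
  funext k
  exact Matrix.one_kronecker_one

theorem IsCP.comp {D : Memory} {E : A.Alg →ₗ[ℂ] B.Alg} {G : B.Alg →ₗ[ℂ] D.Alg}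
    (hG : IsCP G) (hE : IsCP E) : IsCP (G ∘ₗ E) :=
  fun C X hX => hG C _ (hE C X hX)

/-- The memory with one block of size one. -/
def trivial : Memory where
  Idx := Unit
  Blk := fun _ => Unit

theorem IsCP.isPos {E : A.Alg →ₗ[ℂ] B.Alg} (hE : IsCP E) {a : A.Alg} (ha : IsPos a) :
    IsPos (E a) := by
  have h := hE trivial (fun k => (a k.2).submatrix Prod.snd Prod.snd)
    (isPos_iff.2 fun k => (isPos_iff.1 ha k.2).submatrix _)
  exact isPos_iff.2 fun k =>
    (isPos_iff.1 h ((), k)).submatrix (fun i : B.Blk k => (((), i) : Unit × B.Blk k))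

theorem IsDecayOp.comp {D : Memory} {E : A.Alg →ₗ[ℂ] B.Alg} {G : B.Alg →ₗ[ℂ] D.Alg}
    (hG : IsDecayOp G) (hE : IsDecayOp E) : IsDecayOp (G ∘ₗ E) := by
  refine ⟨hG.1.comp hE.1, ?_⟩
  have h := (hG.1.isPos hE.2).add hG.2
  rw [map_sub] at h
  rw [LinearMap.comp_apply]
  convert h using 1
  abel

/-- Fills in the code at those N for which the asymptotic construction gives nothing. -/
theorem isDecayOp_zero : IsDecayOp (0 : A.Alg →ₗ[ℂ] B.Alg) := by
  refine ⟨fun C X _ => ?_, ?_⟩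
  · have : idTensor C (0 : A.Alg →ₗ[ℂ] B.Alg) X = 0 := rfl
    rw [this]; exact IsPos.zero
  · simpa using IsPos.one

/-- The map `a ↦ (∑ k, W l k * a k * (W l k)ᴴ)_l`. -/
noncomputable def kraus (W : ∀ (l : B.Idx) (k : A.Idx), Matrix (B.Blk l) (A.Blk k) ℂ) :
    A.Alg →ₗ[ℂ] B.Alg where
  toFun a := fun l => ∑ k, W l k * a k * (W l k).conjTranspose
  map_add' a b := by
    funext l
    simp [Matrix.mul_add, Matrix.add_mul, Finset.sum_add_distrib]
  map_smul' z a := by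
    funext l
    simp [Finset.smul_sum]

theorem kraus_apply (W : ∀ (l : B.Idx) (k : A.Idx), Matrix (B.Blk l) (A.Blk k) ℂ) (a : A.Alg)
    (l : B.Idx) : kraus W a l = ∑ k, W l k * a k * (W l k).conjTranspose := rfl

theorem one_kronecker_mul_mul_apply {c m n : Type*} [Fintype c] [DecidableEq c] [Fintype m]
    (W : Matrix n m ℂ) (V : Matrix m n ℂ) (X : Matrix (c × m) (c × m) ℂ) (u v : c × n) :
    (((1 : Matrix c c ℂ) ⊗ₖ W) * X * ((1 : Matrix c c ℂ) ⊗ₖ V)) u v =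
      (W * (Matrix.of fun x y => X (u.1, x) (v.1, y)) * V) u.2 v.2 := by
  simp only [Matrix.mul_apply, Matrix.kroneckerMap_apply, Matrix.of_apply, Fintype.sum_prod_type,
    Matrix.one_apply]
  rw [Finset.sum_eq_single v.1]
  · simp [Finset.sum_ite_irrel, ite_mul]
  · intro b _ hb
    simp [hb]
  · simp

theorem isCP_kraus (W : ∀ (l : B.Idx) (k : A.Idx), Matrix (B.Blk l) (A.Blk k) ℂ) :
    IsCP (kraus W) := by
  intro C X hX
  refine isPos_iff.2 fun k => ?_
  have h : idTensor C (kraus W) X k = ∑ a, ((1 : Matrix (C.Blk k.1) (C.Blk k.1) ℂ) ⊗ₖ W k.2 a) *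
      X (k.1, a) * ((1 : Matrix (C.Blk k.1) (C.Blk k.1) ℂ) ⊗ₖ W k.2 a).conjTranspose := by
    ext u v
    change (∑ a, W k.2 a * (Matrix.of fun x y => X (k.1, a) (u.1, x) (v.1, y)) *
      (W k.2 a).conjTranspose) u.2 v.2 = _
    rw [Matrix.sum_apply, Matrix.sum_apply]
    refine Finset.sum_congr rfl fun a _ => ?_
    rw [Matrix.conjTranspose_kronecker, Matrix.conjTranspose_one, one_kronecker_mul_mul_apply]
  rw [h]
  exact Matrix.posSemidef_sum _ fun a _ =>
    (isPos_iff.1 hX (k.1, a)).mul_mul_conjTranspose_same _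

/-! ### Cauchy–Schwarz for states. -/

namespace State

variable (ρ : A.State)

theorem re_nonneg {a : A.Alg} (ha : IsPos a) : 0 ≤ (ρ.toFun a).re :=
  (Complex.nonneg_iff.1 (ρ.nonneg a ha)).1

theorem im_eq_zero {a : A.Alg} (ha : IsPos a) : (ρ.toFun a).im = 0 :=
  (Complex.nonneg_iff.1 (ρ.nonneg a ha)).2.symm

theorem eq_ofReal {a : A.Alg} (ha : IsPos a) : ρ.toFun a = ((ρ.toFun a).re : ℂ) :=
  Complex.ext rfl (by simpa using ρ.im_eq_zero ha)

theorem re_mono {a b : A.Alg} (h : IsPos (b - a)) : (ρ.toFun a).re ≤ (ρ.toFun b).re := by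
  have := ρ.re_nonneg h
  rw [map_sub, Complex.sub_re] at this
  linarith

theorem re_le_one {a : A.Alg} (h : IsPos (1 - a)) : (ρ.toFun a).re ≤ 1 := by
  simpa [ρ.map_one] using ρ.re_mono h

/-- The semi-inner product `σ(a* b)` that a state defines. -/
@[reducible] def innerCore : PreInnerProductSpace.Core ℂ A.Alg where
  inner a b := ρ.toFun (star a * b)
  conj_inner_symm a b := by
    change star (ρ.toFun (star b * a)) = _
    rw [← ρ.map_star, star_mul, star_star]
  re_inner_nonneg a := ρ.re_nonneg ⟨a, rfl⟩
  add_left a b c := by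
    change ρ.toFun (star (a + b) * c) = ρ.toFun (star a * c) + ρ.toFun (star b * c)
    rw [star_add, add_mul, map_add]
  smul_left a b z := by
    change ρ.toFun (star (z • a) * b) = star z * ρ.toFun (star a * b)
    rw [star_smul, smul_mul_assoc, map_smul, smul_eq_mul]

theorem norm_sq_le (a b : A.Alg) :
    ‖ρ.toFun (star a * b)‖ ^ 2 ≤ (ρ.toFun (star a * a)).re * (ρ.toFun (star b * b)).re := by
  let := ρ.innerCore
  have h := InnerProductSpace.Core.inner_mul_inner_self_le (𝕜 := ℂ) a b
  have e : ‖ρ.toFun (star b * a)‖ = ‖ρ.toFun (star a * b)‖ := by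
    rw [← norm_star, ← ρ.map_star, star_mul, star_star]
  change ‖ρ.toFun (star a * b)‖ * ‖ρ.toFun (star b * a)‖ ≤ _ at h
  rw [e] at h
  rw [sq]
  exact h

theorem norm_le_sqrt (a b : A.Alg) {x : ℝ} (ha : (ρ.toFun (star a * a)).re ≤ x)
    (hb : (ρ.toFun (star b * b)).re ≤ 1) : ‖ρ.toFun (star a * b)‖ ≤ Real.sqrt x := by
  refine Real.le_sqrt_of_sq_le ((ρ.norm_sq_le a b).trans ?_)
  have h0 := ρ.re_nonneg ⟨a, rfl⟩
  have h1 := ρ.re_nonneg ⟨b, rfl⟩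
  nlinarith

end State

/-! ### Diagonalized functionals and bounds for the complete fidelity. -/

/-- A simultaneous diagonalization of the density matrices of a state: the eigenvalues `p k j` and
the unitary matrices `U k` of eigenvectors. -/
structure SpectralForm (φ : A.Alg →ₗ[ℂ] ℂ) where
  p : ∀ k, A.Blk k → ℝ
  U : ∀ k, Matrix (A.Blk k) (A.Blk k) ℂ
  nonneg : ∀ k j, 0 ≤ p k j
  sum_eq_one : ∑ k, ∑ j, p k j = 1
  unitary : ∀ k, (U k).conjTranspose * U k = 1
  apply : ∀ a, φ a = ∑ k, ∑ j, (p k j : ℂ) * ((U k).conjTranspose * a k * U k) j j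

namespace SpectralForm

variable {φ : A.Alg →ₗ[ℂ] ℂ}

theorem unitary' (S : SpectralForm φ) (k : A.Idx) : S.U k * (S.U k).conjTranspose = 1 :=
  mul_eq_one_comm.1 (S.unitary k)

theorem apply_nonneg (S : SpectralForm φ) {a : A.Alg} (ha : IsPos a) : 0 ≤ φ a := by
  rw [S.apply]
  refine Finset.sum_nonneg fun k _ => Finset.sum_nonneg fun j _ => mul_nonneg ?_ ?_
  · exact_mod_cast S.nonneg k j
  · exact ((isPos_iff.1 ha k).conjTranspose_mul_mul_same (S.U k)).diag_nonneg

theorem apply_one (S : SpectralForm φ) : φ 1 = 1 := by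
  rw [S.apply]
  simp only [Pi.one_apply, mul_one, S.unitary, Matrix.one_apply_eq]
  exact_mod_cast S.sum_eq_one

/-- The total density in a block. -/
def w (S : SpectralForm φ) (k : A.Idx) : ℝ := ∑ j, S.p k j

theorem w_nonneg (S : SpectralForm φ) (k : A.Idx) : 0 ≤ S.w k :=
  Finset.sum_nonneg fun j _ => S.nonneg k j

theorem sum_w (S : SpectralForm φ) : ∑ k, S.w k = 1 := S.sum_eq_one

end SpectralForm

theorem exists_block_of_nontrivial (h : Nontrivial C.Alg) : ∃ k : C.Idx, Nonempty (C.Blk k) := by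
  by_contra hc
  push Not at hc
  obtain ⟨a, b, hab⟩ := h
  exact hab (funext fun k => by
    have := hc k
    ext i
    exact isEmptyElim i)

/-- The product of φ with a vector state of C, read off as one diagonal entry in C. It makes the set
of extensions nonempty; otherwise `sInf` would take its default value 0. -/
theorem SpectralForm.exists_extension {φ : A.Alg →ₗ[ℂ] ℂ} (S : SpectralForm φ)
    (hC : Nontrivial C.Alg) : ∃ σ : (C.tensor A).State, ∀ a, σ.toFun (tmul 1 a) = φ a := by
  obtain ⟨k, ⟨u⟩⟩ := exists_block_of_nontrivial hC
  let r : (C.tensor A).Alg →ₗ[ℂ] A.Alg :=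
    { toFun := fun X a => (X (k, a)).submatrix (fun x => (u, x)) (fun x => (u, x))
      map_add' := fun X Y => rfl
      map_smul' := fun z X => rfl }
  have hr : ∀ a : A.Alg, r (tmul 1 a) = a := by
    intro a
    funext b
    ext x y
    change ((1 : C.Alg) k ⊗ₖ a b) (u, x) (u, y) = _
    simp
  refine ⟨⟨φ ∘ₗ r, fun a ha => S.apply_nonneg (isPos_iff.2 fun b =>
    (isPos_iff.1 ha (k, b)).submatrix _), ?_⟩, fun a => ?_⟩
  · rw [LinearMap.comp_apply, ← tmul_one_one, hr, S.apply_one]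
  · rw [LinearMap.comp_apply, hr]

/-- The difference is (id ⊗ E)(1 − P) + 1 ⊗ (1 − E(1)), a sum of positive elements. -/
theorem idTensor_subunital {E : A.Alg →ₗ[ℂ] A.Alg} (hE : IsDecayOp E) {P : (C.tensor A).Alg}
    (hP : IsPos (1 - P)) : IsPos (1 - idTensor C E P) := by
  have h1 := hE.1 C _ hP
  have h2 : IsPos (1 - idTensor C E 1) := by
    rw [← tmul_one_one, idTensor_one]
    refine isPos_iff.2 fun k => ?_
    have h := (Matrix.PosSemidef.one (n := C.Blk k.1) (R := ℂ)).kronecker (isPos_iff.1 hE.2 k.2)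
    have e : (tmul 1 1 - tmul 1 (E 1) : (C.tensor A).Alg) k
        = (1 : Matrix (C.Blk k.1) (C.Blk k.1) ℂ) ⊗ₖ ((1 - E 1) k.2) := by
      ext i j
      simp only [tmul, Pi.sub_apply, Matrix.sub_apply, Matrix.kroneckerMap_apply, mul_sub,
        Pi.one_apply]
    rw [e]
    exact h
  rw [map_sub] at h1
  have h := h1.add h2
  convert h using 1
  abel

theorem norm_sub_idTensor_le_one {E : A.Alg →ₗ[ℂ] A.Alg} (hE : IsDecayOp E)
    (σ : (C.tensor A).State) {P : (C.tensor A).Alg} (hP : IsPos P) (hP' : IsPos (1 - P)) :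
    ‖σ.toFun P - (σ.toFun ∘ₗ idTensor C E) P‖ ≤ 1 := by
  have hQ := hE.1 C _ hP
  have hQ' := idTensor_subunital hE hP'
  rw [LinearMap.comp_apply, σ.eq_ofReal hP, σ.eq_ofReal hQ, ← Complex.ofReal_sub, Complex.norm_real,
    Real.norm_eq_abs, abs_le]
  have h1 := σ.re_nonneg hP
  have h2 := σ.re_nonneg hQ
  have h3 := σ.re_le_one hP'
  have h4 := σ.re_le_one hQ'
  constructor <;> linarith

/-- Supplies the lower bound without which the real `sInf` is not a genuine infimum. -/
theorem fidelityWith_nonneg {E : A.Alg →ₗ[ℂ] A.Alg} (hE : IsDecayOp E) (φ : A.Alg →ₗ[ℂ] ℂ) :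
    0 ≤ fidelityWith C φ E := by
  refine Real.sInf_nonneg ?_
  rintro x ⟨σ, -, rfl⟩
  have : traceDist σ.toFun (σ.toFun ∘ₗ idTensor C E) ≤ 1 := by
    refine Real.sSup_le ?_ zero_le_one
    rintro x ⟨P, hP, hP', rfl⟩
    exact norm_sub_idTensor_le_one hE σ hP hP'
  linarith

/-- A test `P` on an extension of the state bounds the complete fidelity from above. -/
theorem completeFidelity_le {E : A.Alg →ₗ[ℂ] A.Alg} (hE : IsDecayOp E) {φ : A.Alg →ₗ[ℂ] ℂ}
    (hC : Nontrivial C.Alg) (σ : (C.tensor A).State) (hσ : ∀ a, σ.toFun (tmul 1 a) = φ a)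
    {P : (C.tensor A).Alg} (hP : IsPos P) (hP' : IsPos (1 - P)) :
    completeFidelity φ E ≤ 1 - (σ.toFun P).re + (σ.toFun (idTensor C E P)).re := by
  have h1 : completeFidelity φ E ≤ fidelityWith C φ E := by
    refine csInf_le ⟨0, ?_⟩ ⟨C, hC, rfl⟩
    rintro x ⟨D, -, rfl⟩
    exact fidelityWith_nonneg hE φ
  have hb : ∀ τ : (C.tensor A).State, BddAbove {x : ℝ | ∃ P : (C.tensor A).Alg, IsPos P ∧
      IsPos (1 - P) ∧ x = ‖τ.toFun P - (τ.toFun ∘ₗ idTensor C E) P‖} := by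
    refine fun τ => ⟨1, ?_⟩
    rintro x ⟨P, hP, hP', rfl⟩
    exact norm_sub_idTensor_le_one hE τ hP hP'
  have h2 : fidelityWith C φ E ≤ 1 - traceDist σ.toFun (σ.toFun ∘ₗ idTensor C E) := by
    refine csInf_le ⟨0, ?_⟩ ⟨σ, hσ, rfl⟩
    rintro x ⟨τ, -, rfl⟩
    have : traceDist τ.toFun (τ.toFun ∘ₗ idTensor C E) ≤ 1 := by
      refine Real.sSup_le ?_ zero_le_one
      rintro x ⟨P, hP, hP', rfl⟩
      exact norm_sub_idTensor_le_one hE τ hP hP'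
    linarith
  have h3 : ‖σ.toFun P - (σ.toFun ∘ₗ idTensor C E) P‖
      ≤ traceDist σ.toFun (σ.toFun ∘ₗ idTensor C E) :=
    le_csSup (hb σ) ⟨P, hP, hP', rfl⟩
  have h4 := (Complex.re_le_norm _).trans h3
  rw [Complex.sub_re, LinearMap.comp_apply] at h4
  linarith

theorem nontrivial_trivial : Nontrivial trivial.Alg :=
  ⟨0, 1, fun h => by
    have h' : (0 : ℂ) = (1 : Matrix Unit Unit ℂ) () () :=
      congrFun (congrFun (congrFun h ()) ()) ()
    simp at h'⟩

theorem SpectralForm.completeFidelity_le_one {φ : A.Alg →ₗ[ℂ] ℂ} (S : SpectralForm φ)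
    {E : A.Alg →ₗ[ℂ] A.Alg} (hE : IsDecayOp E) : completeFidelity φ E ≤ 1 := by
  obtain ⟨σ, hσ⟩ := S.exists_extension nontrivial_trivial
  have := completeFidelity_le hE nontrivial_trivial σ hσ (P := 0) IsPos.zero
    (by rw [sub_zero]; exact IsPos.one)
  simpa using this

theorem SpectralForm.le_completeFidelity {φ : A.Alg →ₗ[ℂ] ℂ} (S : SpectralForm φ)
    {E : A.Alg →ₗ[ℂ] A.Alg} {x : ℝ} (hx : 0 ≤ x)
    (h : ∀ (C : Memory) (σ : (C.tensor A).State), (∀ a, σ.toFun (tmul 1 a) = φ a) →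
      ∀ P, IsPos P → IsPos (1 - P) → ‖σ.toFun P - σ.toFun (idTensor C E P)‖ ≤ x) :
    1 - x ≤ completeFidelity φ E := by
  refine le_csInf ⟨_, trivial, nontrivial_trivial, rfl⟩ ?_
  rintro y ⟨C, hC, rfl⟩
  obtain ⟨σ, hσ⟩ := S.exists_extension hC
  refine le_csInf ⟨_, σ, hσ, rfl⟩ ?_
  rintro y ⟨τ, hτ, rfl⟩
  have : traceDist τ.toFun (τ.toFun ∘ₗ idTensor C E) ≤ x := by
    refine Real.sSup_le ?_ hx
    rintro z ⟨P, hP, hP', rfl⟩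
    exact h C τ hτ P hP hP'
  linarith

/-! ### Eigenvalues of a state and of its tensor powers. -/

namespace State

variable (ρ : A.State)

theorem apply_eq_sum (a : A.Alg) :
    ρ.toFun a = ∑ k, ∑ i, ∑ j, a k i j * ρ.toFun (A.unit k i j) := by
  have h : a = ∑ k, ∑ i, ∑ j, a k i j • A.unit k i j := by
    funext l
    ext x y
    simp only [Finset.sum_apply, Pi.smul_apply, Matrix.sum_apply, Matrix.smul_apply, unit]
    rw [Finset.sum_eq_single l]
    · simp only [Pi.single_eq_same, smul_eq_mul]
      rw [Finset.sum_eq_single x, Finset.sum_eq_single y]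
      · simp
      · intro j _ hj; simp [hj]
      · simp
      · intro i _ hi; simp [hi]
      · simp
    · intro k _ hk
      simp [Pi.single_eq_of_ne (Ne.symm hk)]
    · simp
  conv_lhs => rw [h]
  simp only [map_sum, map_smul, smul_eq_mul]

/-- The quadratic form of the density matrix at v is the value of the state on the positive element
vv* of that block. -/
theorem density_posSemidef (k : A.Idx) : (ρ.density k).PosSemidef := by
  refine Matrix.PosSemidef.of_dotProduct_mulVec_nonneg (ρ.density_isHermitian k) fun v => ?_
  have h := ρ.nonneg (Pi.single k (Matrix.vecMulVec v (star v))) (isPos_iff.2 fun l => by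
    by_cases hl : l = k
    · subst hl
      rw [Pi.single_eq_same]
      exact Matrix.posSemidef_vecMulVec_self_star v
    · rw [Pi.single_eq_of_ne hl]
      exact Matrix.PosSemidef.zero)
  rw [ρ.apply_eq_sum, Finset.sum_eq_single k] at h
  · convert h using 1
    simp only [dotProduct, Matrix.mulVec, density, Matrix.of_apply, Pi.single_eq_same,
      Matrix.vecMulVec_apply, Finset.mul_sum]
    rw [Finset.sum_comm]
    refine Finset.sum_congr rfl fun i _ => Finset.sum_congr rfl fun j _ => ?_
    ring
  · intro l _ hl
    simp [Pi.single_eq_of_ne hl]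
  · simp

theorem eigenvalue_nonneg (k : A.Idx) (j : A.Blk k) : 0 ≤ ρ.eigenvalue k j :=
  (ρ.density_posSemidef k).eigenvalues_nonneg j

theorem sum_eigenvalue : ∑ k, ∑ j, ρ.eigenvalue k j = 1 := by
  have h : ρ.toFun 1 = ∑ k, (ρ.density k).trace := by
    rw [ρ.apply_eq_sum]
    refine Finset.sum_congr rfl fun k _ => Finset.sum_congr rfl fun i _ => ?_
    rw [Finset.sum_eq_single i]
    · simp [density]
    · intro j _ hj
      simp [Matrix.one_apply_ne (Ne.symm hj)]
    · simp
  rw [ρ.map_one] at h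
  simp only [(ρ.density_isHermitian _).trace_eq_sum_eigenvalues] at h
  have h' := congrArg Complex.re h
  simpa [eigenvalue] using h'.symm

theorem sum_weight : ∑ k, ρ.weight k = 1 := ρ.sum_eigenvalue

/-- The unitary matrix of eigenvectors of the density matrix. -/
noncomputable def eigenbasis (k : A.Idx) : Matrix (A.Blk k) (A.Blk k) ℂ :=
  ((ρ.density_isHermitian k).eigenvectorUnitary : Matrix (A.Blk k) (A.Blk k) ℂ)

theorem eigenbasis_unitary (k : A.Idx) :
    (ρ.eigenbasis k).conjTranspose * ρ.eigenbasis k = 1 := by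
  rw [← Matrix.star_eq_conjTranspose]
  exact Unitary.coe_star_mul_self _

theorem apply_unit (k : A.Idx) (i j : A.Blk k) : ρ.toFun (A.unit k i j) =
    ∑ m, (ρ.eigenvalue k m : ℂ) * (star (ρ.eigenbasis k i m) * ρ.eigenbasis k j m) := by
  have h : ρ.toFun (A.unit k i j) = ρ.density k j i := rfl
  rw [h, (ρ.density_isHermitian k).spectral_theorem, Unitary.conjStarAlgAut_apply,
    Matrix.mul_apply]
  refine Finset.sum_congr rfl fun m _ => ?_
  rw [Matrix.mul_diagonal, Matrix.star_apply]
  change _ * (ρ.eigenvalue k m : ℂ) * _ = _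
  simp only [eigenbasis]
  ring

/-- The diagonalization of a power of a state. -/
noncomputable def powSpectralForm (N : ℕ) : SpectralForm (ρ.pow N) where
  p := fun K J => ∏ l, ρ.eigenvalue (K l) (J l)
  U := fun K => Matrix.of fun x J => ∏ l, ρ.eigenbasis (K l) (x l) (J l)
  nonneg := fun K J => Finset.prod_nonneg fun l _ => ρ.eigenvalue_nonneg _ _
  sum_eq_one := by
    have h1 : ∀ K : Fin N → A.Idx, ∑ J : (∀ l, A.Blk (K l)), ∏ l, ρ.eigenvalue (K l) (J l)
        = ∏ l, ∑ j, ρ.eigenvalue (K l) j := fun K => by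
      rw [Finset.prod_univ_sum, Fintype.piFinset_univ]
    have h2 : ∑ K : Fin N → A.Idx, ∏ l, ∑ j, ρ.eigenvalue (K l) j
        = ∏ _l : Fin N, ∑ k, ∑ j, ρ.eigenvalue k j := by
      rw [Finset.prod_univ_sum, Fintype.piFinset_univ]
    simp only [h1, h2, ρ.sum_eigenvalue, Finset.prod_const_one]
  unitary := fun K => by
    ext J J'
    simp only [Matrix.mul_apply, Matrix.conjTranspose_apply, Matrix.of_apply, star_prod,
      ← Finset.prod_mul_distrib]
    have h : ∑ x : (∀ l, A.Blk (K l)), ∏ l,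
        star (ρ.eigenbasis (K l) (x l) (J l)) * ρ.eigenbasis (K l) (x l) (J' l)
        = ∏ l, ∑ x, star (ρ.eigenbasis (K l) x (J l)) * ρ.eigenbasis (K l) x (J' l) := by
      rw [Finset.prod_univ_sum, Fintype.piFinset_univ]
    rw [h]
    have h' : ∀ l, ∑ x, star (ρ.eigenbasis (K l) x (J l)) * ρ.eigenbasis (K l) x (J' l)
        = (1 : Matrix (A.Blk (K l)) (A.Blk (K l)) ℂ) (J l) (J' l) := fun l => by
      rw [← ρ.eigenbasis_unitary, Matrix.mul_apply]
      rfl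
    simp only [h', Matrix.one_apply]
    by_cases hJ : J = J'
    · subst hJ; simp
    · obtain ⟨l, hl⟩ := Function.ne_iff.1 hJ
      rw [if_neg hJ]
      exact Finset.prod_eq_zero (Finset.mem_univ l) (if_neg hl)
  apply := fun a => by
    change ∑ K : Fin N → A.Idx, ∑ J : (∀ l, A.Blk (K l)), ∑ J' : (∀ l, A.Blk (K l)),
      a K J J' * ∏ l, ρ.toFun (A.unit (K l) (J l) (J' l)) = _
    refine Finset.sum_congr rfl fun K _ => ?_
    have h : ∀ J J' : (∀ l, A.Blk (K l)), ∏ l, ρ.toFun (A.unit (K l) (J l) (J' l))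
        = ∑ M : (∀ l, A.Blk (K l)), ((∏ l, ρ.eigenvalue (K l) (M l) : ℝ) : ℂ) *
          (star (∏ l, ρ.eigenbasis (K l) (J l) (M l)) * ∏ l, ρ.eigenbasis (K l) (J' l) (M l)) := by
      intro J J'
      simp only [ρ.apply_unit]
      rw [Finset.prod_univ_sum, Fintype.piFinset_univ]
      refine Finset.sum_congr rfl fun M _ => ?_
      rw [star_prod, Complex.ofReal_prod, ← Finset.prod_mul_distrib, ← Finset.prod_mul_distrib]
    simp only [h, Matrix.mul_apply, Matrix.conjTranspose_apply, Matrix.of_apply, Finset.mul_sum,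
      Finset.sum_mul]
    rw [Finset.sum_congr rfl fun J _ => Finset.sum_comm, Finset.sum_comm]
    refine Finset.sum_congr rfl fun M _ => ?_
    rw [Finset.sum_comm]
    refine Finset.sum_congr rfl fun J _ => Finset.sum_congr rfl fun J' _ => ?_
    ring

end State

/-! ### Compression by a projection. -/

theorem idTensor_compression {E : A.Alg →ₗ[ℂ] A.Alg} {P : A.Alg} (hE : ∀ a, E a = P * a * P)
    (Q : (C.tensor A).Alg) : idTensor C E Q = tmul 1 P * Q * tmul 1 P := by
  funext k
  ext u v
  change E (fun a => Matrix.of fun x y => Q (k.1, a) (u.1, x) (v.1, y)) k.2 u.2 v.2 = _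
  rw [hE]
  exact (one_kronecker_mul_mul_apply (P k.2) (P k.2) (Q k) u v).symm

theorem tmul_mul_tmul (a b : A.Alg) :
    (tmul 1 a * tmul 1 b : (C.tensor A).Alg) = tmul 1 (a * b) := by
  funext k
  change (1 : Matrix (C.Blk k.1) (C.Blk k.1) ℂ) ⊗ₖ a k.2 * _ ⊗ₖ b k.2 = _ ⊗ₖ _
  rw [← Matrix.mul_kronecker_mul]
  simp

theorem star_tmul (a : A.Alg) : star (tmul 1 a : (C.tensor A).Alg) = tmul 1 (star a) := by
  funext k
  change ((1 : Matrix (C.Blk k.1) (C.Blk k.1) ℂ) ⊗ₖ a k.2).conjTranspose = _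
  rw [Matrix.conjTranspose_kronecker, Matrix.conjTranspose_one]
  rfl

theorem tmul_sub (a b : A.Alg) :
    (tmul 1 (a - b) : (C.tensor A).Alg) = tmul 1 a - tmul 1 b := by
  funext k
  ext i j
  simp only [tmul, Pi.sub_apply, Matrix.sub_apply, Matrix.kroneckerMap_apply, mul_sub]

/-- A projection that has almost full probability hardly disturbs a state. -/
theorem State.norm_sub_compression_le (σ : A.State) {p : A.Alg} (hp : star p = p)
    (hpp : p * p = p) {Q : A.Alg} (hQ : IsPos Q) (hQ' : IsPos (1 - Q)) :
    ‖σ.toFun Q - σ.toFun (p * Q * p)‖ ≤ 2 * Real.sqrt (σ.toFun (1 - p)).re := by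
  set q := 1 - p with hq
  have hqs : star q = q := by rw [hq, star_sub, star_one, hp]
  have hqq : q * q = q := by rw [hq]; noncomm_ring; rw [hpp]; abel
  -- Both terms, qQ and pQq, contain q at an end, so Cauchy–Schwarz bounds each by √σ(q).
  have e : Q - p * Q * p = star q * Q + star (Q * p) * q := by
    rw [hqs, star_mul, hQ.star_eq, hp, hq]; noncomm_ring
  have hQ2 : (σ.toFun (star Q * Q)).re ≤ 1 :=
    (σ.re_mono (hQ.mul_self_le hQ')).trans (σ.re_le_one hQ')
  have h1 : ‖σ.toFun (star q * Q)‖ ≤ Real.sqrt (σ.toFun q).re := by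
    refine σ.norm_le_sqrt q Q ?_ hQ2
    rw [hqs, hqq]
  have h2 : ‖σ.toFun (star (Q * p) * q)‖ ≤ Real.sqrt (σ.toFun q).re := by
    rw [show star (Q * p) * q = star (star q * (Q * p)) by rw [star_mul, star_mul, star_star, star_mul, mul_assoc], σ.map_star,
      norm_star]
    refine σ.norm_le_sqrt q (Q * p) ?_ ?_
    · rw [hqs, hqq]
    -- pQ²p ≤ 1 because 1 − pQ²p = p(1 − Q²)p + (1 − p).
    · have h3 : IsPos (1 - star Q * Q) := by
        have := (hQ.mul_self_le hQ').add hQ'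
        convert this using 1; abel
      have h4 := h3.star_mul_mul p
      have h5 : IsPos (1 - p) := ⟨q, by rw [hqs, hqq]⟩
      refine σ.re_le_one ?_
      have h6 := h4.add h5
      convert h6 using 1
      rw [star_mul, hp]
      have : p * (1 - star Q * Q) * p = p * p - p * star Q * Q * p := by noncomm_ring
      rw [this, hpp]
      noncomm_ring
  rw [← map_sub, e, map_add]
  linarith [norm_add_le (σ.toFun (star q * Q)) (σ.toFun (star (Q * p) * q))]

theorem SpectralForm.le_completeFidelity_of_compression {φ : A.Alg →ₗ[ℂ] ℂ} (S : SpectralForm φ)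
    {E : A.Alg →ₗ[ℂ] A.Alg} {P : A.Alg} (hE : ∀ a, E a = P * a * P) (hP : star P = P)
    (hPP : P * P = P) : 1 - 2 * Real.sqrt (φ (1 - P)).re ≤ completeFidelity φ E := by
  refine S.le_completeFidelity (by positivity) fun C σ hσ Q hQ hQ' => ?_
  have h := σ.norm_sub_compression_le (p := tmul 1 P) (by rw [star_tmul, hP])
    (by rw [tmul_mul_tmul, hPP]) hQ hQ'
  rw [← idTensor_compression hE] at h
  have e : (1 - tmul 1 P : (C.tensor A).Alg) = tmul 1 (1 - P) := by rw [tmul_sub, tmul_one_one]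
  rwa [e, hσ] at h

/-! ### Codes from partial injections of eigenvectors. -/

section Encoding

variable (f : (Σ k, A.Blk k) → Option (Σ l, B.Blk l))

/-- The matrix of a partial injection of basis vectors. -/
noncomputable def partialMatrix (l : B.Idx) (k : A.Idx) : Matrix (B.Blk l) (A.Blk k) ℂ :=
  Matrix.of fun y j => if f ⟨k, j⟩ = some ⟨l, y⟩ then 1 else 0

variable {f} (hf : ∀ z z' x, f z = some x → f z' = some x → z = z') {β : A.Idx → B.Idx}
  (hβ : ∀ k j x, f ⟨k, j⟩ = some x → x.1 = β k)

include hf hβ in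
-- Injectivity makes the product diagonal. Since all of block k goes to block β k, only one storage
-- block contributes; this is what keeps coherence within a block, and the whole compression is a
-- single term.
theorem partialMatrix_conjTranspose_mul (l : B.Idx) (k : A.Idx) :
    (partialMatrix f l k).conjTranspose * partialMatrix f l k =
      if l = β k then Matrix.diagonal (fun j => if (f ⟨k, j⟩).isSome then 1 else 0) else 0 := by
  ext j j'
  simp only [Matrix.mul_apply, Matrix.conjTranspose_apply, partialMatrix, Matrix.of_apply]
  by_cases hl : l = β k
  · subst hl
    rw [if_pos rfl, Matrix.diagonal_apply]
    by_cases hj : j = j'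
    · subst hj
      rw [if_pos rfl]
      cases h : f ⟨k, j⟩ with
      | none => simp
      | some x =>
        obtain ⟨l, y⟩ := x
        obtain rfl : l = β k := hβ k j _ h
        simp
    · rw [if_neg hj]
      refine Finset.sum_eq_zero fun y _ => ?_
      by_cases h1 : f ⟨k, j⟩ = some ⟨β k, y⟩
      · rw [if_neg (c := f ⟨k, j'⟩ = _) (fun h2 => hj (by simpa using hf ⟨k, j⟩ ⟨k, j'⟩ _ h1 h2)), mul_zero]
      · rw [if_neg h1, star_zero, zero_mul]
  · rw [if_neg hl, Matrix.zero_apply]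
    refine Finset.sum_eq_zero fun y _ => ?_
    rw [if_neg (fun h => hl (hβ k j _ h)), star_zero, zero_mul]

include hf in
theorem partialMatrix_conjTranspose_mul_of_ne (l : B.Idx) {k k' : A.Idx} (hk : k ≠ k') :
    (partialMatrix f l k).conjTranspose * partialMatrix f l k' = 0 := by
  ext j j'
  simp only [Matrix.mul_apply, Matrix.conjTranspose_apply, partialMatrix, Matrix.of_apply,
    Matrix.zero_apply]
  refine Finset.sum_eq_zero fun y _ => ?_
  by_cases h1 : f ⟨k, j⟩ = some ⟨l, y⟩
  · rw [if_neg (fun h2 => hk (congrArg Sigma.fst (hf ⟨k, j⟩ ⟨k', j'⟩ _ h1 h2))), mul_zero]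
  · rw [if_neg h1, star_zero, zero_mul]

include hf in
-- The sum is diagonal and counts the preimages of each basis vector, at most one by injectivity.
theorem one_sub_sum_partialMatrix_posSemidef (l : B.Idx) :
    (1 - ∑ k, partialMatrix f l k * (partialMatrix f l k).conjTranspose).PosSemidef := by
  have h : 1 - ∑ k, partialMatrix f l k * (partialMatrix f l k).conjTranspose
      = Matrix.diagonal (fun y => 1 - ∑ z : (Σ k, A.Blk k), if f z = some ⟨l, y⟩ then (1:ℂ) else 0)
      := by
    ext y y'
    simp only [Matrix.sub_apply, Matrix.sum_apply, Matrix.mul_apply, Matrix.conjTranspose_apply,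
      partialMatrix, Matrix.of_apply]
    by_cases hy : y = y'
    · subst hy
      rw [Matrix.one_apply_eq, Matrix.diagonal_apply_eq, Fintype.sum_sigma]
      congr 1
      refine Finset.sum_congr rfl fun k _ => Finset.sum_congr rfl fun j _ => ?_
      split_ifs <;> simp
    · rw [Matrix.one_apply_ne hy, Matrix.diagonal_apply_ne _ hy, zero_sub, neg_eq_zero]
      refine Finset.sum_eq_zero fun k _ => Finset.sum_eq_zero fun j _ => ?_
      by_cases h1 : f ⟨k, j⟩ = some ⟨l, y⟩
      · rw [h1]
        simp [hy]
      · rw [if_neg h1, zero_mul]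
  rw [h]
  refine Matrix.PosSemidef.diagonal fun y => ?_
  rw [Pi.zero_apply, sub_nonneg, Finset.sum_boole]
  have : (Finset.univ.filter fun z => f z = some (⟨l, y⟩ : Σ l, B.Blk l)).card ≤ 1 :=
    Finset.card_le_one.2 fun a ha b hb =>
      hf _ _ _ (Finset.mem_filter.1 ha).2 (Finset.mem_filter.1 hb).2
  exact_mod_cast this

include hf hβ in
/-- A partial injection of eigenvectors that preserves blocks yields a code that keeps
the encoded eigenvectors. -/
theorem SpectralForm.exists_code {φ : A.Alg →ₗ[ℂ] ℂ} (S : SpectralForm φ) :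
    ∃ (Y : A.Alg →ₗ[ℂ] B.Alg) (X : B.Alg →ₗ[ℂ] A.Alg), IsDecayOp Y ∧ IsDecayOp X ∧
      1 - 2 * Real.sqrt (∑ k, ∑ j, if (f ⟨k, j⟩).isSome then 0 else S.p k j)
        ≤ completeFidelity φ (X ∘ₗ Y) := by
  set W : ∀ (l : B.Idx) (k : A.Idx), Matrix (B.Blk l) (A.Blk k) ℂ :=
    fun l k => partialMatrix f l k * (S.U k).conjTranspose with hW
  set D : A.Alg := fun k => Matrix.diagonal (fun j => if (f ⟨k, j⟩).isSome then 1 else 0) with hD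
  set P : A.Alg := fun k => S.U k * D k * (S.U k).conjTranspose with hP
  have hU : ∀ k {n : Type} (M : Matrix (A.Blk k) n ℂ), (S.U k).conjTranspose * (S.U k * M) = M :=
    fun k n M => by rw [← Matrix.mul_assoc, S.unitary, Matrix.one_mul]
  have hDs : ∀ k, (D k).conjTranspose = D k := fun k => by
    simp only [hD, Matrix.diagonal_conjTranspose]
    congr 1
    funext j
    rw [Pi.star_apply]
    split_ifs <;> simp
  have hDD : ∀ k, D k * D k = D k := fun k => by
    simp [hD, Matrix.diagonal_mul_diagonal]
  have hWW : ∀ l k, (W l k).conjTranspose * W l k = if l = β k then P k else 0 := fun l k => by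
    rw [hW, Matrix.conjTranspose_mul, Matrix.conjTranspose_conjTranspose, Matrix.mul_assoc,
      ← Matrix.mul_assoc (partialMatrix f l k).conjTranspose, partialMatrix_conjTranspose_mul hf hβ]
    split_ifs
    · rw [← Matrix.mul_assoc]
    · simp
  have hWW' : ∀ l {k k'}, k ≠ k' → (W l k).conjTranspose * W l k' = 0 := fun l k k' hk => by
    rw [hW, Matrix.conjTranspose_mul, Matrix.mul_assoc,
      ← Matrix.mul_assoc (partialMatrix f l k).conjTranspose,
      partialMatrix_conjTranspose_mul_of_ne hf l hk]
    simp
  have hPs : star P = P := by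
    funext k
    change (P k).conjTranspose = _
    simp only [hP, Matrix.conjTranspose_mul, Matrix.conjTranspose_conjTranspose, hDs,
      Matrix.mul_assoc]
  have hPP : P * P = P := by
    funext k
    change P k * P k = P k
    simp only [hP, Matrix.mul_assoc, hU]
    rw [← Matrix.mul_assoc (D k), hDD]
  have hP1 : IsPos (1 - P) := by
    refine ⟨1 - P, ?_⟩
    rw [star_sub, star_one, hPs]
    noncomm_ring
    rw [hPP]; abel
  refine ⟨kraus W, kraus fun k l => (W l k).conjTranspose, ⟨isCP_kraus _, ?_⟩,
    ⟨isCP_kraus _, ?_⟩, ?_⟩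
  · refine isPos_iff.2 fun l => ?_
    have e : (1 - kraus W 1) l
        = 1 - ∑ k, partialMatrix f l k * (partialMatrix f l k).conjTranspose := by
      rw [Pi.sub_apply, kraus_apply]
      congr 1
      refine Finset.sum_congr rfl fun k _ => ?_
      rw [hW, Pi.one_apply, Matrix.mul_one, Matrix.conjTranspose_mul,
        Matrix.conjTranspose_conjTranspose, Matrix.mul_assoc, hU]
    rw [e]
    exact one_sub_sum_partialMatrix_posSemidef hf l
  · convert hP1 using 2
    funext k
    simp [kraus_apply, hWW]
  · have hE : ∀ a, ((kraus fun k l => (W l k).conjTranspose) ∘ₗ kraus W) a = P * a * P := by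
      intro a
      funext k
      rw [LinearMap.comp_apply, kraus_apply]
      have : ∀ l, (W l k).conjTranspose * kraus W a l * (W l k).conjTranspose.conjTranspose
          = if l = β k then P k * a k * P k else 0 := by
        intro l
        rw [kraus_apply, Matrix.conjTranspose_conjTranspose, Matrix.mul_sum, Matrix.sum_mul,
          Finset.sum_eq_single k]
        · rw [show (W l k).conjTranspose * (W l k * a k * (W l k).conjTranspose) * W l k
            = ((W l k).conjTranspose * W l k) * a k * ((W l k).conjTranspose * W l k) by
            simp only [Matrix.mul_assoc], hWW]
          split_ifs <;> simp
        · intro k' _ hk'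
          rw [← Matrix.mul_assoc (W l k).conjTranspose, ← Matrix.mul_assoc (W l k).conjTranspose,
            hWW' l (Ne.symm hk')]
          simp only [Matrix.zero_mul]
        · simp
      simp only [this, Finset.sum_ite_eq', Finset.mem_univ, if_true]
      rfl
    convert S.le_completeFidelity_of_compression hE hPs hPP using 4
    rw [S.apply]
    have : ∀ k, (S.U k).conjTranspose * (1 - P) k * S.U k = 1 - D k := fun k => by
      rw [Pi.sub_apply, Pi.one_apply, Matrix.mul_sub, Matrix.sub_mul, Matrix.mul_one, S.unitary]
      congr 1
      simp only [hP, Matrix.mul_assoc, S.unitary, hU, Matrix.mul_one]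
    simp only [this, Complex.re_sum]
    refine Finset.sum_congr rfl fun k _ => Finset.sum_congr rfl fun j _ => ?_
    simp only [hD, Matrix.sub_apply, Matrix.one_apply_eq, Matrix.diagonal_apply_eq]
    split_ifs <;> simp

end Encoding

/-- A typical set of basis vectors fits into blocks with enough room. -/
theorem exists_packing (hB : Nonempty B.Idx) (T : Finset (Σ k, A.Blk k)) (d : ℕ)
    (hT : ∀ k, (Finset.univ.filter fun j => (⟨k, j⟩ : Σ k, A.Blk k) ∈ T).card ≤ d)
    (hK : (T.image Sigma.fst).card ≤ ∑ l : B.Idx, Fintype.card (B.Blk l) / d) :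
    ∃ (f : (Σ k, A.Blk k) → Option (Σ l, B.Blk l)),
      (∀ z z' x, f z = some x → f z' = some x → z = z') ∧
      (∃ β : A.Idx → B.Idx, ∀ k j x, f ⟨k, j⟩ = some x → x.1 = β k) ∧
      ∀ z, (f z).isSome ↔ z ∈ T := by
  classical
  have hcard : Fintype.card (T.image Sigma.fst)
      ≤ Fintype.card (Σ l : B.Idx, Fin (Fintype.card (B.Blk l) / d)) := by
    rw [Fintype.card_coe, Fintype.card_sigma]
    simpa only [Fintype.card_fin] using hK
  obtain ⟨g⟩ := Function.Embedding.nonempty_of_card_le hcard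
  have hcard' : ∀ k, Nonempty ({j // (⟨k, j⟩ : Σ k, A.Blk k) ∈ T} ↪ Fin d) := fun k =>
    Function.Embedding.nonempty_of_card_le (by
      rw [Fintype.card_subtype, Fintype.card_fin]; exact hT k)
  let e := fun k => (hcard' k).some
  -- Cuts block l into ⌊μ_l / d⌋ disjoint slots of d basis vectors; the remainder is wasted.
  let F : (Σ l : B.Idx, Fin (Fintype.card (B.Blk l) / d)) × Fin d → Σ l, B.Blk l := fun x =>
    ⟨x.1.1, (Fintype.equivFin (B.Blk x.1.1)).symm
      (Fin.castLE (Nat.div_mul_le_self _ _) (finProdFinEquiv (x.1.2, x.2)))⟩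
  have hF : Function.Injective F := by
    rintro ⟨⟨l, i⟩, r⟩ ⟨⟨l', i'⟩, r'⟩ h
    obtain rfl : l = l' := congrArg Sigma.fst h
    have h2 := eq_of_heq (Sigma.mk.inj_iff.1 h).2
    have h3 := finProdFinEquiv.injective (Fin.castLE_injective _ (Equiv.injective _ h2))
    simp only [Prod.mk.injEq] at h3
    rw [h3.1, h3.2]
  let f : (Σ k, A.Blk k) → Option (Σ l, B.Blk l) := fun z =>
    if h : z ∈ T then some (F (g ⟨z.1, Finset.mem_image_of_mem _ h⟩, e z.1 ⟨z.2, h⟩)) else none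
  have hf : ∀ z x, f z = some x → ∃ h : z ∈ T,
      x = F (g ⟨z.1, Finset.mem_image_of_mem _ h⟩, e z.1 ⟨z.2, h⟩) := by
    intro z x hz
    by_cases h : z ∈ T
    · exact ⟨h, by simpa [f, h] using hz.symm⟩
    · simp [f, h] at hz
  refine ⟨f, ?_, ?_, ?_⟩
  · rintro ⟨k, j⟩ ⟨k', j'⟩ x hz hz'
    obtain ⟨h, rfl⟩ := hf _ _ hz
    obtain ⟨h', hx⟩ := hf _ _ hz'
    have hx' := Prod.ext_iff.1 (hF hx)
    obtain rfl : k = k' := by simpa using g.injective hx'.1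
    have := (e k).injective hx'.2
    simpa using this
  -- Blocks without a vector of `T` get an arbitrary image, which is never used.
  · refine ⟨fun k => if h : k ∈ T.image Sigma.fst then (g ⟨k, h⟩).1 else hB.some, ?_⟩
    intro k j x hx
    obtain ⟨h, rfl⟩ := hf _ _ hx
    have hk : k ∈ T.image Sigma.fst := Finset.mem_image_of_mem Sigma.fst h
    simp only [dif_pos hk, F]
  · intro z
    by_cases h : z ∈ T <;> simp [f, h]

/-! ### The one-shot converse. -/

theorem isPos_single {k : A.Idx} {M : Matrix (A.Blk k) (A.Blk k) ℂ} (hM : M.PosSemidef) :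
    IsPos (Pi.single k M : A.Alg) :=
  isPos_iff.2 fun l => by
    by_cases hl : l = k
    · subst hl
      rwa [Pi.single_eq_same]
    · rw [Pi.single_eq_of_ne hl]
      exact Matrix.PosSemidef.zero

/-- 1 − ff* = (1 − ‖f‖²)·1 + (‖f‖²·1 − ff*), where ‖f‖² is the trace of ff*. -/
theorem one_sub_vecMulVec_posSemidef {n : Type*} [Fintype n] [DecidableEq n] {f : n → ℂ}
    (hf : star f ⬝ᵥ f ≤ 1) : (1 - Matrix.vecMulVec f (star f)).PosSemidef := by
  have h1 := (Matrix.posSemidef_vecMulVec_self_star f).trace_smul_one_sub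
  have h2 : (((1 : ℂ) - star f ⬝ᵥ f) • (1 : Matrix n n ℂ)).PosSemidef :=
    Matrix.PosSemidef.one.smul (sub_nonneg.2 hf)
  rw [Matrix.trace_vecMulVec, dotProduct_comm] at h1
  convert h2.add h1 using 1
  rw [sub_smul, one_smul]
  abel

namespace SpectralForm

variable {φ : A.Alg →ₗ[ℂ] ℂ} (S : SpectralForm φ)

/-- The vector `∑ j, c j • (e j ⊗ u j)`, where the `u j` are the eigenvectors in a block. -/
noncomputable def vec (k : A.Idx) (c : A.Blk k → ℝ) : A.Blk k × A.Blk k → ℂ :=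
  fun x => (c x.1 : ℂ) * S.U k x.2 x.1

theorem vec_dotProduct_vec (k : A.Idx) (c c' : A.Blk k → ℝ) :
    star (S.vec k c) ⬝ᵥ S.vec k c' = ((∑ j, c j * c' j : ℝ) : ℂ) := by
  simp only [dotProduct, Pi.star_apply, vec, Fintype.sum_prod_type]
  rw [Complex.ofReal_sum]
  refine Finset.sum_congr rfl fun j _ => ?_
  have h : ∑ x, star (S.U k x j) * S.U k x j = 1 := by
    have := congrFun (congrFun (S.unitary k) j) j
    rwa [Matrix.mul_apply, Matrix.one_apply_eq] at this
  have h' : ∀ x, star ((c j : ℂ) * S.U k x j) * ((c' j : ℂ) * S.U k x j)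
      = ((c j * c' j : ℝ) : ℂ) * (star (S.U k x j) * S.U k x j) := fun x => by
    rw [star_mul', show star (c j : ℂ) = (c j : ℂ) from Complex.conj_ofReal _]
    push_cast; ring
  simp only [h', ← Finset.mul_sum, h, mul_one]

theorem vec_dotProduct_one_kronecker (k : A.Idx) (c : A.Blk k → ℝ)
    (M : Matrix (A.Blk k) (A.Blk k) ℂ) :
    star (S.vec k c) ⬝ᵥ (((1 : Matrix (A.Blk k) (A.Blk k) ℂ) ⊗ₖ M).mulVec (S.vec k c))
      = ∑ j, ((c j ^ 2 : ℝ) : ℂ) * ((S.U k).conjTranspose * M * S.U k) j j := by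
  have h : ((1 : Matrix (A.Blk k) (A.Blk k) ℂ) ⊗ₖ M).mulVec (S.vec k c)
      = fun x => (c x.1 : ℂ) * (M * S.U k) x.2 x.1 := by
    funext x
    simp only [Matrix.mulVec, dotProduct, vec, Fintype.sum_prod_type, Matrix.kroneckerMap_apply,
      Matrix.mul_apply]
    rw [Finset.sum_eq_single x.1]
    · rw [Finset.mul_sum]
      refine Finset.sum_congr rfl fun y _ => ?_
      rw [Matrix.one_apply_eq]
      ring
    · intro j _ hj
      simp [Matrix.one_apply_ne (Ne.symm hj)]
    · simp
  rw [h]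
  simp only [dotProduct, Pi.star_apply, Fintype.sum_prod_type]
  refine Finset.sum_congr rfl fun j _ => ?_
  rw [Matrix.mul_assoc, Matrix.mul_apply, Finset.mul_sum]
  refine Finset.sum_congr rfl fun x _ => ?_
  change star ((c j : ℂ) * S.U k x j) * _ = _
  rw [star_mul', show star (c j : ℂ) = (c j : ℂ) from Complex.conj_ofReal _,
    Matrix.conjTranspose_apply]
  push_cast
  ring

/-- The purification of a state. -/
noncomputable def purification : (A.tensor A).State where
  toFun :=
    { toFun := fun Q => ∑ k, star (S.vec k fun j => Real.sqrt (S.p k j)) ⬝ᵥ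
        (Q (k, k)).mulVec (S.vec k fun j => Real.sqrt (S.p k j))
      map_add' := fun Q R => by
        simp only [Pi.add_apply, Matrix.add_mulVec, dotProduct_add, Finset.sum_add_distrib]
      map_smul' := fun z Q => by
        simp only [Pi.smul_apply, Matrix.smul_mulVec, dotProduct_smul, Finset.smul_sum,
          RingHom.id_apply] }
  nonneg := fun Q hQ => Finset.sum_nonneg fun k _ =>
    (isPos_iff.1 hQ (k, k)).dotProduct_mulVec_nonneg _
  map_one := by
    rw [← S.apply_one, S.apply]
    refine Finset.sum_congr rfl fun k _ => ?_
    have h := S.vec_dotProduct_one_kronecker k (fun j => Real.sqrt (S.p k j)) 1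
    rw [Matrix.one_kronecker_one] at h
    refine h.trans (Finset.sum_congr rfl fun j _ => ?_)
    rw [Real.sq_sqrt (S.nonneg k j)]
    rfl

theorem purification_apply (Q : (A.tensor A).Alg) : S.purification.toFun Q =
    ∑ k, star (S.vec k fun j => Real.sqrt (S.p k j)) ⬝ᵥ
        (Q (k, k)).mulVec (S.vec k fun j => Real.sqrt (S.p k j)) := rfl

theorem purification_tmul (a : A.Alg) : S.purification.toFun (tmul 1 a) = φ a := by
  rw [S.apply, purification_apply]
  refine Finset.sum_congr rfl fun k _ => ?_
  refine (S.vec_dotProduct_one_kronecker k _ (a k)).trans (Finset.sum_congr rfl fun j _ => ?_)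
  rw [Real.sq_sqrt (S.nonneg k j)]

/-- The projection onto the vectors `S.vec k (c k)`, one in each diagonal block. -/
noncomputable def test (c : ∀ k, A.Blk k → ℝ) : (A.tensor A).Alg :=
  fun K => Matrix.of fun u v =>
    (Pi.single K.1 (Matrix.of fun x y => S.vec K.1 (c K.1) (u.1, x) *
      star (S.vec K.1 (c K.1) (v.1, y))) : A.Alg) K.2 u.2 v.2

variable (c : ∀ k, A.Blk k → ℝ)

theorem test_same (k : A.Idx) :
    S.test c (k, k) = Matrix.vecMulVec (S.vec k (c k)) (star (S.vec k (c k))) := by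
  ext u v
  simp [test, Matrix.vecMulVec_apply]

theorem test_of_ne {k l : A.Idx} (h : l ≠ k) : S.test c (k, l) = 0 := by
  ext u v
  simp [test, Pi.single_eq_of_ne h]

theorem isPos_test : IsPos (S.test c) := by
  refine isPos_iff.2 ?_
  rintro ⟨k, l⟩
  by_cases h : l = k
  · subst h
    rw [test_same]
    exact Matrix.posSemidef_vecMulVec_self_star _
  · rw [S.test_of_ne c h]
    exact Matrix.PosSemidef.zero

theorem isPos_one_sub_test (hc : ∀ k, ∑ j, c k j ^ 2 ≤ 1) : IsPos (1 - S.test c) := by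
  refine isPos_iff.2 ?_
  rintro ⟨k, l⟩
  rw [Pi.sub_apply, Pi.one_apply]
  by_cases h : l = k
  · subst h
    rw [test_same]
    refine one_sub_vecMulVec_posSemidef ?_
    rw [vec_dotProduct_vec]
    simp only [← sq]
    exact_mod_cast hc l
  · rw [S.test_of_ne c h, sub_zero]
    exact Matrix.PosSemidef.one

theorem purification_test : (S.purification.toFun (S.test c)).re =
    ∑ k, (∑ j, c k j * Real.sqrt (S.p k j)) ^ 2 := by
  rw [purification_apply, Complex.re_sum]
  refine Finset.sum_congr rfl fun k _ => ?_
  rw [test_same, Matrix.vecMulVec_mulVec, vec_dotProduct_vec, dotProduct_smul, vec_dotProduct_vec]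
  simp only [MulOpposite.smul_eq_mul_unop, MulOpposite.unop_op, ← Complex.ofReal_mul,
    Complex.ofReal_re, sq]
  congr 1
  exact Finset.sum_congr rfl fun j _ => mul_comm _ _

/-- The operator `∑ j, c j ^ 2 • |u j⟩⟨u j|`. -/
noncomputable def marginal (k : A.Idx) : Matrix (A.Blk k) (A.Blk k) ℂ :=
  S.U k * Matrix.diagonal (fun j => ((c k j ^ 2 : ℝ) : ℂ)) * (S.U k).conjTranspose

theorem smul_one_sub_marginal_posSemidef {k : A.Idx} {x : ℝ} (h : ∀ j, c k j ^ 2 ≤ x) :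
    ((x : ℂ) • (1 : Matrix (A.Blk k) (A.Blk k) ℂ) - S.marginal c k).PosSemidef := by
  have e : (x : ℂ) • (1 : Matrix (A.Blk k) (A.Blk k) ℂ) - S.marginal c k = S.U k *
      Matrix.diagonal (fun j => ((x - c k j ^ 2 : ℝ) : ℂ)) * (S.U k).conjTranspose := by
    have : Matrix.diagonal (fun j => ((x - c k j ^ 2 : ℝ) : ℂ))
        = (x : ℂ) • (1 : Matrix (A.Blk k) (A.Blk k) ℂ) -
          Matrix.diagonal (fun j => ((c k j ^ 2 : ℝ) : ℂ)) := by
      ext i j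
      by_cases hij : i = j
      · subst hij; simp
      · simp [hij]
    rw [this, mul_sub, sub_mul, Matrix.mul_smul, mul_one, Matrix.smul_mul, S.unitary']
    rfl
  rw [e]
  refine (Matrix.PosSemidef.diagonal fun j => ?_).mul_mul_conjTranspose_same _
  rw [Pi.zero_apply]
  exact Complex.zero_le_real.2 (sub_nonneg.2 (h j))

/-- Tracing out the reference commutes with `Y` and turns the test in block k into `marginal`. So
the size of the stored test is governed by the largest squared amplitude. -/
theorem trace_idTensor_test (Y : A.Alg →ₗ[ℂ] B.Alg) (k : A.Idx) (l : B.Idx) :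
    (idTensor A Y (S.test c) (k, l)).trace = (Y (Pi.single k (S.marginal c k)) l).trace := by
  have h : ∀ j y, idTensor A Y (S.test c) (k, l) (j, y) (j, y) =
      Y (Pi.single k (Matrix.of fun x y => S.vec k (c k) (j, x) * star (S.vec k (c k) (j, y)))) l
        y y := fun j y => rfl
  have hs : S.marginal c k
      = ∑ j, Matrix.of fun x y => S.vec k (c k) (j, x) * star (S.vec k (c k) (j, y)) := by
    ext x y
    rw [Matrix.sum_apply, marginal, Matrix.mul_apply]
    refine Finset.sum_congr rfl fun j _ => ?_
    rw [Matrix.mul_diagonal, Matrix.conjTranspose_apply, Matrix.of_apply]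
    change _ = (c k j : ℂ) * S.U k x j * star ((c k j : ℂ) * S.U k y j)
    rw [star_mul', show star (c k j : ℂ) = (c k j : ℂ) from Complex.conj_ofReal _]
    push_cast
    ring
  have hs' : (Pi.single k (S.marginal c k) : A.Alg) = ∑ j, Pi.single k
      (Matrix.of fun x y => S.vec k (c k) (j, x) * star (S.vec k (c k) (j, y))) := by
    rw [hs]
    exact map_sum (AddMonoidHom.single (fun k => Matrix (A.Blk k) (A.Blk k) ℂ) k) _ _
  rw [hs', map_sum, Finset.sum_apply, Matrix.trace_sum]
  simp only [Matrix.trace, Fintype.sum_prod_type, Matrix.diag_apply, h]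

/-- An operator that is scalar in each block acts trivially on the reference, so only the marginal φ
of the purification enters. The inner sum is the joint probability of source block k and storage
block l. -/
theorem purification_idTensor_scalar (X : B.Alg →ₗ[ℂ] A.Alg) (r : A.Idx → B.Idx → ℂ) :
    S.purification.toFun (idTensor A X (fun K => r K.1 K.2 • 1)) = ∑ k, ∑ l, r k l *
      ∑ j, (S.p k j : ℂ) * ((S.U k).conjTranspose * X (Pi.single l 1) k * S.U k) j j := by
  rw [purification_apply]
  refine Finset.sum_congr rfl fun k _ => ?_
  have h : idTensor A X (fun K => r K.1 K.2 • 1) (k, k) =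
      (1 : Matrix (A.Blk k) (A.Blk k) ℂ) ⊗ₖ (∑ l, r k l • X (Pi.single l 1) k) := by
    ext u v
    change X (fun b => Matrix.of fun x y => (r k b • (1 : Matrix (A.Blk k × B.Blk b) _ ℂ))
      (u.1, x) (v.1, y)) k u.2 v.2 = _
    have e : (fun b => Matrix.of fun x y => (r k b • (1 : Matrix (A.Blk k × B.Blk b) _ ℂ))
        (u.1, x) (v.1, y) : B.Alg) = ((1 : Matrix (A.Blk k) (A.Blk k) ℂ) u.1 v.1) •
          ∑ l, r k l • (Pi.single l 1 : B.Alg) := by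
      funext b
      ext x y
      rw [Pi.smul_apply, Finset.sum_apply, Finset.sum_eq_single b]
      · rw [← Matrix.one_kronecker_one]
        simp only [Matrix.of_apply, Matrix.smul_apply, Matrix.kroneckerMap_apply, smul_eq_mul,
          Pi.smul_apply, Pi.single_eq_same]
        ring
      · intro l _ hl
        rw [Pi.smul_apply, Pi.single_eq_of_ne (Ne.symm hl), smul_zero]
      · simp
    rw [e, map_smul, map_sum, Pi.smul_apply, Finset.sum_apply]
    simp only [map_smul, Pi.smul_apply]
    rfl
  rw [h, vec_dotProduct_one_kronecker]
  simp only [Real.sq_sqrt (S.nonneg k _), Matrix.sum_mul, Matrix.mul_smul,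
    Matrix.smul_mul, Matrix.sum_apply, Matrix.smul_apply, Finset.mul_sum, smul_eq_mul]
  rw [Finset.sum_comm]
  refine Finset.sum_congr rfl fun l _ => Finset.sum_congr rfl fun j _ => ?_
  ring

theorem apply_single_nonneg {X : B.Alg →ₗ[ℂ] A.Alg} (hX : IsCP X) (k : A.Idx) (l : B.Idx) :
    0 ≤ ∑ j, (S.p k j : ℂ) * ((S.U k).conjTranspose * X (Pi.single l 1) k * S.U k) j j := by
  refine Finset.sum_nonneg fun j _ => mul_nonneg (by exact_mod_cast S.nonneg k j) ?_
  exact ((isPos_iff.1 (hX.isPos (isPos_single Matrix.PosSemidef.one)) k).conjTranspose_mul_mul_same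
    (S.U k)).diag_nonneg

theorem sum_apply_single_le {X : B.Alg →ₗ[ℂ] A.Alg} (hX : IsDecayOp X) (k : A.Idx) :
    ∑ l, ∑ j, (S.p k j : ℂ) * ((S.U k).conjTranspose * X (Pi.single l 1) k * S.U k) j j
      ≤ S.w k := by
  rw [Finset.sum_comm, w, Complex.ofReal_sum]
  refine Finset.sum_le_sum fun j _ => ?_
  have e : ∑ l, (S.p k j : ℂ) * ((S.U k).conjTranspose * X (Pi.single l 1) k * S.U k) j j
      = (S.p k j : ℂ) * ((S.U k).conjTranspose * X 1 k * S.U k) j j := by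
    have h1 : (1 : B.Alg) = ∑ l, Pi.single l 1 := (Finset.univ_sum_single (1 : B.Alg)).symm
    rw [h1, map_sum, Finset.sum_apply, Matrix.mul_sum, Matrix.sum_mul, Matrix.sum_apply,
      Finset.mul_sum]
  rw [e]
  refine mul_le_of_le_one_right (by exact_mod_cast S.nonneg k j) ?_
  have h := ((isPos_iff.1 hX.2 k).conjTranspose_mul_mul_same (S.U k)).diag_nonneg (i := j)
  rw [Pi.sub_apply, Pi.one_apply, Matrix.mul_sub, Matrix.sub_mul, Matrix.mul_one, S.unitary,
    Matrix.sub_apply, Matrix.one_apply_eq, sub_nonneg] at h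
  exact h

/-- Bounding R by its trace in each block discards everything about it except its size. -/
theorem re_purification_idTensor_le {X : B.Alg →ₗ[ℂ] A.Alg} (hX : IsCP X)
    {R : (A.tensor B).Alg} (hR : IsPos R) :
    (S.purification.toFun (idTensor A X R)).re ≤ ∑ k, ∑ l, (R (k, l)).trace.re *
      (∑ j, (S.p k j : ℂ) * ((S.U k).conjTranspose * X (Pi.single l 1) k * S.U k) j j).re := by
  have h1 : IsPos ((fun K => (R (K.1, K.2)).trace • 1 : (A.tensor B).Alg) - R) :=
    isPos_iff.2 fun K => (isPos_iff.1 hR K).trace_smul_one_sub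
  have h2 := hX A _ h1
  rw [map_sub] at h2
  refine (S.purification.re_mono h2).trans_eq ?_
  rw [S.purification_idTensor_scalar X fun k l => (R (k, l)).trace]
  simp only [Complex.re_sum, Complex.mul_re]
  refine Finset.sum_congr rfl fun k _ => Finset.sum_congr rfl fun l _ => ?_
  have := (Complex.nonneg_iff.1 (isPos_iff.1 hR (k, l)).trace_nonneg).2
  rw [← this]
  simp

end SpectralForm

theorem trace_apply_single_nonneg {Y : A.Alg →ₗ[ℂ] B.Alg} (hY : IsCP Y) (k : A.Idx) (l : B.Idx) :
    0 ≤ (Y (Pi.single k 1) l).trace.re :=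
  (Complex.nonneg_iff.1
    (isPos_iff.1 (hY.isPos (isPos_single Matrix.PosSemidef.one)) l).trace_nonneg).1

/-- Subunitality of `Y`: all source blocks share the dimension of storage block l. -/
theorem sum_trace_apply_single_le {Y : A.Alg →ₗ[ℂ] B.Alg} (hY : IsDecayOp Y) (l : B.Idx) :
    ∑ k, (Y (Pi.single k 1) l).trace.re ≤ Fintype.card (B.Blk l) := by
  have e : ∑ k, (Y (Pi.single k 1) l).trace.re = (Y 1 l).trace.re := by
    have h1 : (1 : A.Alg) = ∑ l, Pi.single l 1 := (Finset.univ_sum_single (1 : A.Alg)).symm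
    rw [h1, map_sum, Finset.sum_apply, Matrix.trace_sum, Complex.re_sum]
  have h := (Complex.nonneg_iff.1 (isPos_iff.1 hY.2 l).trace_nonneg).1
  rw [Pi.sub_apply, Pi.one_apply, Matrix.trace_sub, Matrix.trace_one, Complex.sub_re,
    Complex.natCast_re] at h
  linarith

theorem IsCP.trace_apply_single_le {Y : A.Alg →ₗ[ℂ] B.Alg} (hY : IsCP Y) {k : A.Idx} {x : ℝ}
    {M : Matrix (A.Blk k) (A.Blk k) ℂ}
    (hM : ((x : ℂ) • (1 : Matrix (A.Blk k) (A.Blk k) ℂ) - M).PosSemidef) (l : B.Idx) :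
    (Y (Pi.single k M) l).trace.re ≤ x * (Y (Pi.single k 1) l).trace.re := by
  have h := (Complex.nonneg_iff.1 (isPos_iff.1 (hY.isPos (isPos_single hM)) l).trace_nonneg).1
  rw [Pi.single_sub, Pi.single_smul, map_sub, map_smul, Pi.sub_apply, Pi.smul_apply,
    Matrix.trace_sub, Matrix.trace_smul, Complex.sub_re, smul_eq_mul, Complex.re_ofReal_mul] at h
  linarith

/-- The one-shot converse: a state with a typical set `T` of eigenvectors that have small
probabilities cannot be stored in a memory that has too few large blocks. -/
theorem SpectralForm.completeFidelity_le_of_typical {φ : A.Alg →ₗ[ℂ] ℂ} (S : SpectralForm φ)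
    (T : Finset (Σ k, A.Blk k)) {n d κ : ℝ} (hn : 0 < n) (hd : 0 < d) (hκ : 0 ≤ κ)
    (hw : ∀ z ∈ T, S.w z.1 ≤ 1 / n) (hp : ∀ z ∈ T, S.p z.1 z.2 ≤ S.w z.1 / d)
    {Y : A.Alg →ₗ[ℂ] B.Alg} {X : B.Alg →ₗ[ℂ] A.Alg} (hY : IsDecayOp Y) (hX : IsDecayOp X) :
    completeFidelity φ (X ∘ₗ Y) ≤
      2 * (∑ k, ∑ j, if (⟨k, j⟩ : Σ k, A.Blk k) ∈ T then 0 else S.p k j) + κ +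
      1 / (n * d) * ∑ l, if κ * d < Fintype.card (B.Blk l) then (Fintype.card (B.Blk l) : ℝ)
        else 0 := by
  have hA : Nontrivial A.Alg := ⟨1, 0, fun h => by
    have := S.apply_one
    rw [h, map_zero] at this
    exact zero_ne_one this⟩
  -- Amplitudes of the conditional distribution in block k, cut off outside `T`. Not renormalizing
  -- keeps every squared amplitude at most 1/d; if the weight vanishes, division by zero gives 0.
  set c : ∀ k, A.Blk k → ℝ := fun k j =>
    if (⟨k, j⟩ : Σ k, A.Blk k) ∈ T then Real.sqrt (S.p k j / S.w k) else 0 with hc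
  have hc2 : ∀ k j, c k j ^ 2 = if (⟨k, j⟩ : Σ k, A.Blk k) ∈ T then S.p k j / S.w k else 0 := by
    intro k j
    simp only [hc]
    split_ifs
    · exact Real.sq_sqrt (div_nonneg (S.nonneg k j) (S.w_nonneg k))
    · ring
  have hc1 : ∀ k, ∑ j, c k j ^ 2 ≤ 1 := fun k => by
    have : ∑ j, c k j ^ 2 ≤ ∑ j, S.p k j / S.w k := Finset.sum_le_sum fun j _ => by
      rw [hc2]
      split_ifs
      · exact le_rfl
      · exact div_nonneg (S.nonneg k j) (S.w_nonneg k)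
    refine this.trans ?_
    rw [← Finset.sum_div]
    exact div_self_le_one _
  have hcd : ∀ k j, c k j ^ 2 ≤ 1 / d := fun k j => by
    rw [hc2]
    split_ifs with h
    · rcases (S.w_nonneg k).eq_or_lt with h0 | h0
      · rw [← h0, div_zero]; positivity
      · rw [div_le_iff₀ h0]
        have := hp _ h
        simp only at this
        rw [one_div_mul_eq_div]
        exact this
    · positivity
  set t : A.Idx → B.Idx → ℝ := fun k l =>
    (∑ j, (S.p k j : ℂ) * ((S.U k).conjTranspose * X (Pi.single l 1) k * S.U k) j j).re with ht
  have ht0 : ∀ k l, 0 ≤ t k l := fun k l =>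
    (Complex.nonneg_iff.1 (S.apply_single_nonneg hX.1 k l)).1
  have htw : ∀ k, ∑ l, t k l ≤ S.w k := fun k => by
    have := (Complex.le_def.1 (S.sum_apply_single_le hX k)).1
    rwa [Complex.re_sum, Complex.ofReal_re] at this
  set q : A.Idx → B.Idx → ℝ := fun k l => (Y (Pi.single k 1) l).trace.re with hq
  have hq0 : ∀ k l, 0 ≤ q k l := trace_apply_single_nonneg hY.1
  have hqs : ∀ l, ∑ k, q k l ≤ Fintype.card (B.Blk l) := sum_trace_apply_single_le hY
  have hR : ∀ k l, (idTensor A Y (S.test c) (k, l)).trace.re ≤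
      if ∃ j, (⟨k, j⟩ : Σ k, A.Blk k) ∈ T then 1 / d * q k l else 0 := by
    intro k l
    rw [S.trace_idTensor_test]
    split_ifs with h
    · exact hY.1.trace_apply_single_le (S.smul_one_sub_marginal_posSemidef c (hcd k)) l
    · have := hY.1.trace_apply_single_le (S.smul_one_sub_marginal_posSemidef (x := 0) c
        (k := k) fun j => by
          rw [hc2, if_neg]
          exact fun hj => h ⟨j, hj⟩) l
      simpa using this
  have hstored : (S.purification.toFun (idTensor A (X ∘ₗ Y) (S.test c))).re ≤
      κ + 1 / (n * d) * ∑ l, if κ * d < Fintype.card (B.Blk l) then (Fintype.card (B.Blk l) : ℝ)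
        else 0 := by
    rw [idTensor_comp]
    refine (S.re_purification_idTensor_le hX.1 (hY.1 A _ (S.isPos_test c))).trans ?_
    -- In a small storage block q/d ≤ κ, and the numbers t sum to at most 1. In a large one t ≤ 1/n,
    -- and q summed over k is at most the dimension.
    have hterm : ∀ k l, (idTensor A Y (S.test c) (k, l)).trace.re * t k l ≤
        κ * t k l + 1 / (n * d) * (if κ * d < Fintype.card (B.Blk l) then q k l else 0) := by
      intro k l
      refine (mul_le_mul_of_nonneg_right (hR k l) (ht0 k l)).trans ?_
      have hq1 : q k l ≤ Fintype.card (B.Blk l) :=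
        (Finset.single_le_sum (fun k _ => hq0 k l) (Finset.mem_univ k)).trans (hqs l)
      split_ifs with h1 h2 h2
      · obtain ⟨j, hj⟩ := h1
        have h3 : t k l ≤ 1 / n :=
          ((Finset.single_le_sum (fun l _ => ht0 k l) (Finset.mem_univ l)).trans (htw k)).trans
            (hw _ hj)
        have h4 : 1 / d * q k l * t k l ≤ 1 / d * q k l * (1 / n) :=
          mul_le_mul_of_nonneg_left h3 (mul_nonneg (by positivity) (hq0 k l))
        have h5 : 1 / (n * d) * q k l = 1 / d * q k l * (1 / n) := by
          field_simp
        have := mul_nonneg hκ (ht0 k l)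
        linarith
      · have h3 : 1 / d * q k l ≤ κ := by
          rw [one_div_mul_eq_div, div_le_iff₀ hd]
          linarith
        have := mul_le_mul_of_nonneg_right h3 (ht0 k l)
        linarith
      · have := mul_nonneg hκ (ht0 k l)
        have : 0 ≤ 1 / (n * d) * q k l := mul_nonneg (by positivity) (hq0 k l)
        linarith
      · have := mul_nonneg hκ (ht0 k l)
        linarith
    refine (Finset.sum_le_sum fun k _ => Finset.sum_le_sum fun l _ => hterm k l).trans ?_
    simp only [Finset.sum_add_distrib, ← Finset.mul_sum]
    refine add_le_add ?_ (mul_le_mul_of_nonneg_left ?_ (by positivity))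
    · refine mul_le_of_le_one_right hκ ?_
      calc ∑ k, ∑ l, t k l ≤ ∑ k, S.w k := Finset.sum_le_sum fun k _ => htw k
        _ = 1 := S.sum_w
    · rw [Finset.sum_comm]
      refine Finset.sum_le_sum fun l _ => ?_
      split_ifs
      · exact hqs l
      · simp
  have htest : 1 - 2 * (∑ k, ∑ j, if (⟨k, j⟩ : Σ k, A.Blk k) ∈ T then 0 else S.p k j)
      ≤ (S.purification.toFun (S.test c)).re := by
    rw [S.purification_test]
    have h1 : 1 - 2 * (∑ k, ∑ j, if (⟨k, j⟩ : Σ k, A.Blk k) ∈ T then 0 else S.p k j)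
        = ∑ k, (2 * (∑ j, if (⟨k, j⟩ : Σ k, A.Blk k) ∈ T then S.p k j else 0) - S.w k) := by
      have h2 : ∀ k, (∑ j, if (⟨k, j⟩ : Σ k, A.Blk k) ∈ T then S.p k j else 0)
          = S.w k - ∑ j, if (⟨k, j⟩ : Σ k, A.Blk k) ∈ T then 0 else S.p k j := fun k => by
        rw [w, ← Finset.sum_sub_distrib]
        refine Finset.sum_congr rfl fun j _ => ?_
        split_ifs <;> ring
      simp only [h2, mul_sub, Finset.sum_sub_distrib, ← Finset.mul_sum, S.sum_w]
      ring
    rw [h1]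
    -- With a the typical weight of the block and w its weight, the test gives a²/w ≥ 2a − w, that
    -- is (a − w)² ≥ 0. Summed, this loses only twice the atypical probability.
    refine Finset.sum_le_sum fun k _ => ?_
    set a := ∑ j, if (⟨k, j⟩ : Σ k, A.Blk k) ∈ T then S.p k j else 0 with ha
    have h3 : ∑ j, c k j * Real.sqrt (S.p k j) = a / Real.sqrt (S.w k) := by
      rw [ha, Finset.sum_div]
      refine Finset.sum_congr rfl fun j _ => ?_
      simp only [hc]
      split_ifs
      · rw [Real.sqrt_div (S.nonneg k j), div_mul_eq_mul_div, Real.mul_self_sqrt (S.nonneg k j)]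
      · simp
    rw [h3, div_pow, Real.sq_sqrt (S.w_nonneg k)]
    rcases (S.w_nonneg k).eq_or_lt with h0 | h0
    · have : a ≤ S.w k := Finset.sum_le_sum fun j _ => by
        split_ifs
        · exact le_rfl
        · exact S.nonneg k j
      rw [← h0] at this ⊢
      rw [div_zero]
      linarith
    · rw [le_div_iff₀ h0]
      nlinarith [sq_nonneg (a - S.w k)]
  have h := completeFidelity_le (hX.comp hY) hA S.purification S.purification_tmul
    (S.isPos_test c) (S.isPos_one_sub_test c hc1)
  linarith

end Memory

/-! ### Large deviations for independent letters. -/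

section WordProb

variable {ι : Type*} [Fintype ι] {α : ι → Type*} [∀ k, Fintype (α k)]

open Classical in
/-- The probability of a set of words of length `N`, for independent letters with distribution `p`
on pairs `(k, j)` with `j : α k`. -/
noncomputable def wordProb (p : ∀ k, α k → ℝ) (N : ℕ)
    (E : ∀ K : Fin N → ι, (∀ l, α (K l)) → Prop) : ℝ :=
  ∑ K : Fin N → ι, ∑ J : (∀ l, α (K l)), if E K J then ∏ l, p (K l) (J l) else 0

variable {p : ∀ k, α k → ℝ}

theorem sum_sum_prod (g : ∀ k, α k → ℝ) (N : ℕ) :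
    ∑ K : Fin N → ι, ∑ J : (∀ l, α (K l)), ∏ l, g (K l) (J l) = (∑ k, ∑ j, g k j) ^ N := by
  classical
  have h1 : ∀ K : Fin N → ι, ∑ J : (∀ l, α (K l)), ∏ l, g (K l) (J l)
      = ∏ l, ∑ j, g (K l) j := fun K => by
    rw [Finset.prod_univ_sum, Fintype.piFinset_univ]
  have h2 : ∑ K : Fin N → ι, ∏ l, ∑ j, g (K l) j = ∏ _l : Fin N, ∑ k, ∑ j, g k j := by
    rw [Finset.prod_univ_sum, Fintype.piFinset_univ]
  simp only [h1, h2, Finset.prod_const, Finset.card_univ, Fintype.card_fin]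

theorem wordProb_nonneg (hp : ∀ k j, 0 ≤ p k j) (N : ℕ)
    (E : ∀ K : Fin N → ι, (∀ l, α (K l)) → Prop) : 0 ≤ wordProb p N E := by
  refine Finset.sum_nonneg fun K _ => Finset.sum_nonneg fun J _ => ?_
  split_ifs
  · exact Finset.prod_nonneg fun l _ => hp _ _
  · exact le_rfl

/-- The union bound. Words with a null letter carry no probability and need not be checked, so that
logarithms of eigenvalues may be used freely. -/
theorem wordProb_le_add (hp : ∀ k j, 0 ≤ p k j) {N : ℕ}
    {E E₁ E₂ : ∀ K : Fin N → ι, (∀ l, α (K l)) → Prop}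
    (h : ∀ K J, (∀ l, 0 < p (K l) (J l)) → E K J → E₁ K J ∨ E₂ K J) :
    wordProb p N E ≤ wordProb p N E₁ + wordProb p N E₂ := by
  simp only [wordProb, ← Finset.sum_add_distrib]
  refine Finset.sum_le_sum fun K _ => Finset.sum_le_sum fun J _ => ?_
  have h0 : 0 ≤ ∏ l, p (K l) (J l) := Finset.prod_nonneg fun l _ => hp _ _
  by_cases hpos : ∀ l, 0 < p (K l) (J l)
  · have := h K J hpos
    split_ifs <;> first | linarith | tauto
  · push Not at hpos
    obtain ⟨l, hl⟩ := hpos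
    have : ∏ l, p (K l) (J l) = 0 :=
      Finset.prod_eq_zero (Finset.mem_univ l) (le_antisymm hl (hp _ _))
    simp [this]

theorem wordProb_mono (hp : ∀ k j, 0 ≤ p k j) {N : ℕ}
    {E E' : ∀ K : Fin N → ι, (∀ l, α (K l)) → Prop}
    (h : ∀ K J, (∀ l, 0 < p (K l) (J l)) → E K J → E' K J) :
    wordProb p N E ≤ wordProb p N E' := by
  have := wordProb_le_add hp (E := E) (E₁ := E') (E₂ := fun _ _ => False)
    fun K J h1 h2 => Or.inl (h K J h1 h2)
  simpa [wordProb] using this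

theorem wordProb_add_not (hs : ∑ k, ∑ j, p k j = 1) {N : ℕ}
    (E : ∀ K : Fin N → ι, (∀ l, α (K l)) → Prop) :
    wordProb p N E + wordProb p N (fun K J => ¬ E K J) = 1 := by
  simp only [wordProb, ← Finset.sum_add_distrib]
  rw [← one_pow N, ← hs, ← sum_sum_prod]
  refine Finset.sum_congr rfl fun K _ => Finset.sum_congr rfl fun J _ => ?_
  split_ifs <;> simp

/-- The Chernoff bound. -/
theorem exists_wordProb_le_exp (hp : ∀ k j, 0 ≤ p k j) (hs : ∑ k, ∑ j, p k j = 1)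
    (f : ∀ k, α k → ℝ) {a : ℝ} (ha : a < ∑ k, ∑ j, p k j * f k j) :
    ∃ c : ℝ, 0 < c ∧ ∀ N : ℕ,
      wordProb p N (fun K J => ∑ l, f (K l) (J l) ≤ N * a) ≤ Real.exp (-c * N) := by
  set g : ℝ → ℝ := fun θ => ∑ k, ∑ j, p k j * Real.exp (-θ * (f k j - a)) with hg
  have hg0 : g 0 = 1 := by simp [hg, hs]
  have hd : HasDerivAt g (∑ k, ∑ j, p k j * -(f k j - a)) 0 := by
    refine HasDerivAt.fun_sum fun k _ => HasDerivAt.fun_sum fun j _ => ?_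
    have h1 : HasDerivAt (fun θ : ℝ => -θ * (f k j - a)) (-(f k j - a)) 0 := by
      simpa using (hasDerivAt_id (0 : ℝ)).neg.mul_const (f k j - a)
    simpa using h1.exp.const_mul (p k j)
  have hneg : ∑ k, ∑ j, p k j * -(f k j - a) < 0 := by
    have : ∑ k, ∑ j, p k j * -(f k j - a) = a - ∑ k, ∑ j, p k j * f k j := by
      have h1 : ∀ k j, p k j * -(f k j - a) = p k j * a - p k j * f k j := fun k j => by ring
      simp only [h1, Finset.sum_sub_distrib, ← Finset.sum_mul, hs, one_mul]
    linarith
  -- The exponential moment is 1 at θ = 0 with derivative a − mean < 0, so it drops below 1 for some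
  -- θ > 0.
  obtain ⟨θ, hθ0, hθ⟩ : ∃ θ : ℝ, 0 < θ ∧ g θ < 1 := by
    have h1 := hasDerivAt_iff_tendsto_slope_zero.1 hd
    have h2 := (h1.mono_left (nhdsGT_le_nhdsNE 0)).eventually (eventually_lt_nhds hneg)
    obtain ⟨θ, h3, h4⟩ := (h2.and self_mem_nhdsWithin).exists
    refine ⟨θ, h4, ?_⟩
    rw [zero_add, hg0, smul_eq_mul] at h3
    have h5 : 0 < θ := h4
    by_contra h6
    have : 0 ≤ θ⁻¹ * (g θ - 1) := mul_nonneg (inv_nonneg.2 h5.le) (by linarith)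
    linarith
  -- The rate comes from g ≤ e^{g − 1}.
  refine ⟨1 - g θ, by linarith, fun N => ?_⟩
  calc wordProb p N (fun K J => ∑ l, f (K l) (J l) ≤ N * a)
      ≤ ∑ K : Fin N → ι, ∑ J : (∀ l, α (K l)),
          ∏ l, p (K l) (J l) * Real.exp (-θ * (f (K l) (J l) - a)) := by
        refine Finset.sum_le_sum fun K _ => Finset.sum_le_sum fun J _ => ?_
        rw [Finset.prod_mul_distrib, ← Real.exp_sum]
        have h0 : 0 ≤ ∏ l, p (K l) (J l) := Finset.prod_nonneg fun l _ => hp _ _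
        split_ifs with h
        · refine le_mul_of_one_le_right h0 (Real.one_le_exp ?_)
          rw [← Finset.mul_sum, Finset.sum_sub_distrib]
          simp only [Finset.sum_const, Finset.card_univ, Fintype.card_fin, nsmul_eq_mul]
          nlinarith
        · positivity
    _ = g θ ^ N := sum_sum_prod (fun k j => p k j * Real.exp (-θ * (f k j - a))) N
    _ ≤ Real.exp (-(1 - g θ)) ^ N := by
        refine pow_le_pow_left₀ ?_ ?_ N
        · exact Finset.sum_nonneg fun k _ => Finset.sum_nonneg fun j _ =>
            mul_nonneg (hp k j) (Real.exp_pos _).le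
        · have := Real.add_one_le_exp (-(1 - g θ))
          linarith
    _ = Real.exp (-(1 - g θ) * N) := by rw [← Real.exp_nat_mul]; ring_nf

theorem tendsto_exp_neg_mul_nat {c : ℝ} (hc : 0 < c) :
    Tendsto (fun N : ℕ => Real.exp (-c * N)) atTop (𝓝 0) := by
  refine Real.tendsto_exp_atBot.comp ?_
  exact tendsto_natCast_atTop_atTop.const_mul_atTop_of_neg (by linarith)

theorem tendsto_wordProb_lower (hp : ∀ k j, 0 ≤ p k j) (hs : ∑ k, ∑ j, p k j = 1)
    (f : ∀ k, α k → ℝ) {a : ℝ} (ha : a < ∑ k, ∑ j, p k j * f k j) :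
    Tendsto (fun N : ℕ => wordProb p N (fun K J => ∑ l, f (K l) (J l) ≤ N * a)) atTop (𝓝 0) := by
  obtain ⟨c, hc, h⟩ := exists_wordProb_le_exp hp hs f ha
  exact squeeze_zero (fun N => wordProb_nonneg hp N _) h (tendsto_exp_neg_mul_nat hc)

/-- For a nonnegative variable, sums that exceed the mean by a constant factor are unlikely. -/
theorem tendsto_wordProb_upper (hp : ∀ k j, 0 ≤ p k j) (hs : ∑ k, ∑ j, p k j = 1)
    (f : ∀ k, α k → ℝ) (hf : ∀ k j, 0 < p k j → 0 ≤ f k j) {m ε : ℝ}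
    (hm : ∑ k, ∑ j, p k j * f k j = m) (hε : 0 < ε) :
    Tendsto (fun N : ℕ => wordProb p N (fun K J => N * (m * (1 + ε)) < ∑ l, f (K l) (J l)))
      atTop (𝓝 0) := by
  have hpf : ∀ k j, 0 ≤ p k j * f k j := fun k j => by
    rcases (hp k j).eq_or_lt with h | h
    · rw [← h, zero_mul]
    · exact mul_nonneg h.le (hf k j h)
  have hm0 : 0 ≤ m := hm ▸ Finset.sum_nonneg fun k _ => Finset.sum_nonneg fun j _ => hpf k j
  rcases hm0.eq_or_lt with h0 | h0
  -- With mean 0 the relative margin mε vanishes and Chernoff does not apply, but f is then zero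
  -- almost surely.
  · have h1 : ∀ k j, p k j * f k j = 0 := fun k j => by
      rw [← h0] at hm
      have h2 := (Finset.sum_eq_zero_iff_of_nonneg
        fun k _ => Finset.sum_nonneg fun j _ => hpf k j).1 hm k (Finset.mem_univ k)
      exact (Finset.sum_eq_zero_iff_of_nonneg fun j _ => hpf k j).1 h2 j (Finset.mem_univ j)
    refine tendsto_const_nhds.congr fun N => Eq.symm (le_antisymm ?_ (wordProb_nonneg hp N _))
    refine (wordProb_mono hp (E' := fun _ _ => False) fun K J hpos h => ?_).trans
      (by simp [wordProb])
    rw [← h0, zero_mul, mul_zero] at h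
    refine h.ne' (Finset.sum_eq_zero fun l _ => ?_)
    exact (mul_eq_zero.1 (h1 _ _)).resolve_left (hpos l).ne'
  · have h1 := tendsto_wordProb_lower hp hs (fun k j => -f k j) (a := -(m * (1 + ε))) (by
      simp only [mul_neg, Finset.sum_neg_distrib, hm]
      nlinarith)
    refine squeeze_zero (fun N => wordProb_nonneg hp N _) (fun N => ?_) h1
    refine wordProb_mono hp fun K J _ h => ?_
    simp only [Finset.sum_neg_distrib]
    linarith

end WordProb

/-! ### Gibbs weights and duality. -/

section Gibbs

variable {ι : Type*} {μ : ι → ℝ}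

theorem rpow_mul_log_div (hμ : ∀ k, 0 ≤ μ k) {s z : ℝ} (hs : 1 ≤ s) (hz : 0 < z) (k : ι) :
    Real.negMulLog (μ k ^ s / z) =
      μ k ^ s / z * Real.log z - s * (μ k ^ s / z * Real.log (μ k)) := by
  rcases (hμ k).eq_or_lt with h | h
  · rw [← h, Real.zero_rpow (by linarith)]
    simp
  · rw [Real.negMulLog, Real.log_div (Real.rpow_pos_of_pos h s).ne' hz.ne', Real.log_rpow h]
    ring

variable [Fintype ι]

/-- The weights μ_k^s / z have entropy log z − s·E, where E is their mean of log μ. If E = y this is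
at least x. If s = 1, entropy plus E is log z whatever E is, so E ≥ y suffices. -/
theorem exists_weights_of_gibbs (hμ : ∀ k, 0 ≤ μ k) {x y s : ℝ} (hs : 1 ≤ s)
    (hz : 0 < ∑ k, μ k ^ s) (h : x + s * y ≤ Real.log (∑ k, μ k ^ s))
    (hy : y ≤ ∑ k, μ k ^ s / (∑ k, μ k ^ s) * Real.log (μ k))
    (hy' : s = 1 ∨ ∑ k, μ k ^ s / (∑ k, μ k ^ s) * Real.log (μ k) = y) :
    ∃ r : ι → ℝ, (∀ k, 0 ≤ r k) ∧ ∑ k, r k = 1 ∧ (∀ k, μ k = 0 → r k = 0) ∧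
      y ≤ ∑ k, r k * Real.log (μ k) ∧
      x + y ≤ ∑ k, Real.negMulLog (r k) + ∑ k, r k * Real.log (μ k) := by
  set z := ∑ k, μ k ^ s with hzdef
  have hsum : ∑ k, μ k ^ s / z = 1 := by rw [← Finset.sum_div, div_self hz.ne']
  refine ⟨fun k => μ k ^ s / z, fun k => div_nonneg (Real.rpow_nonneg (hμ k) s) hz.le, hsum,
    fun k hk => by simp only [hk]; rw [Real.zero_rpow (by linarith), zero_div], hy, ?_⟩
  simp only [rpow_mul_log_div hμ hs hz, Finset.sum_sub_distrib, ← Finset.sum_mul,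
    ← Finset.mul_sum, hsum, one_mul]
  rcases hy' with h1 | h1
  · subst h1; linarith
  · rw [h1]; linarith

open Classical in
theorem tendsto_sum_pow_mul {u : ι → ℝ} (hu : ∀ k, 0 ≤ u k) (hu' : ∀ k, u k ≤ 1) (c : ι → ℝ) :
    Tendsto (fun n : ℕ => ∑ k, u k ^ n * c k) atTop (𝓝 (∑ k, if u k = 1 then c k else 0)) := by
  refine tendsto_finsetSum _ fun k _ => ?_
  by_cases h : u k = 1
  · simp [h]
  · rw [if_neg h]
    have h1 : u k < 1 := lt_of_le_of_ne (hu' k) h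
    simpa using (tendsto_pow_atTop_nhds_zero_of_lt_one (hu k) h1).mul_const (c k)

/-- The dual description of the upper boundary of the capacity region. -/
theorem exists_weights (hμ : ∀ k, 0 ≤ μ k) (hμ' : ∃ k, 0 < μ k) {x y : ℝ}
    (h : ∀ s : ℝ, 1 ≤ s → x + s * y ≤ Real.log (∑ k, μ k ^ s)) :
    ∃ r : ι → ℝ, (∀ k, 0 ≤ r k) ∧ ∑ k, r k = 1 ∧ (∀ k, μ k = 0 → r k = 0) ∧
      y ≤ ∑ k, r k * Real.log (μ k) ∧
      x + y ≤ ∑ k, Real.negMulLog (r k) + ∑ k, r k * Real.log (μ k) := by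
  classical
  obtain ⟨k₀, hk₀⟩ := hμ'
  have hz : ∀ s : ℝ, 0 < ∑ k, μ k ^ s := fun s =>
    Finset.sum_pos' (fun k _ => Real.rpow_nonneg (hμ k) s)
      ⟨k₀, Finset.mem_univ _, Real.rpow_pos_of_pos hk₀ s⟩
  set g : ℝ → ℝ := fun s => ∑ k, μ k ^ s / (∑ k, μ k ^ s) * Real.log (μ k) with hg
  -- At s = 1 the Gibbs weights already have enough mean log-dimension. Otherwise s is increased
  -- until the mean equals y, or, if no s suffices, one passes to the limit s → ∞.
  by_cases h1 : y ≤ g 1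
  · exact exists_weights_of_gibbs hμ le_rfl (hz 1) (h 1 le_rfl) h1 (Or.inl rfl)
  push Not at h1
  by_cases h2 : ∃ s, 1 ≤ s ∧ y ≤ g s
  · obtain ⟨s, hs, hys⟩ := h2
    have hrpow : ∀ k, ContinuousOn (fun s : ℝ => μ k ^ s) (Set.Icc 1 s) := fun k t ht =>
      (Real.continuousAt_const_rpow' (by linarith [ht.1])).continuousWithinAt
    have hcont : ContinuousOn g (Set.Icc 1 s) :=
      continuousOn_finsetSum _ fun k _ => ((hrpow k).div
        (continuousOn_finsetSum _ fun k _ => hrpow k) fun t _ => (hz t).ne').mul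
          continuousOn_const
    obtain ⟨t, ht, hgt⟩ := intermediate_value_Icc hs hcont ⟨h1.le, hys⟩
    exact exists_weights_of_gibbs hμ ht.1 (hz t) (h t ht.1) hgt.ge (Or.inr hgt)
  push Not at h2
  obtain ⟨k₁, -, hk₁⟩ := Finset.exists_max_image Finset.univ μ ⟨k₀, Finset.mem_univ _⟩
  set m := μ k₁ with hm
  have hm0 : 0 < m := hk₀.trans_le (hk₁ k₀ (Finset.mem_univ _))
  set u : ι → ℝ := fun k => μ k / m with hu
  have hu0 : ∀ k, 0 ≤ u k := fun k => div_nonneg (hμ k) hm0.le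
  have hu1 : ∀ k, u k ≤ 1 := fun k => (div_le_one hm0).2 (hk₁ k (Finset.mem_univ _))
  have huone : ∀ k, u k = 1 ↔ μ k = m := fun k => div_eq_one_iff_eq hm0.ne'
  have hpow : ∀ (n : ℕ) k, μ k ^ (n : ℝ) = m ^ n * u k ^ n := fun n k => by
    rw [Real.rpow_natCast, ← mul_pow, hu, mul_div_cancel₀ _ hm0.ne']
  -- The hypothesis at s = n with the factor m^n split off, so that the sum on the right stays
  -- bounded.
  have hlog : ∀ n : ℕ, 1 ≤ n → x + n * (y - Real.log m) ≤ Real.log (∑ k, u k ^ n) := by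
    intro n hn
    have h3 := h n (by exact_mod_cast hn)
    have hz' := hz n
    simp only [hpow, ← Finset.mul_sum] at h3 hz'
    have h4 : 0 < ∑ k, u k ^ n := pos_of_mul_pos_right hz' (by positivity)
    rw [Real.log_mul (by positivity) h4.ne', Real.log_pow] at h3
    linarith
  set M : ℝ := ∑ k, if μ k = m then (1 : ℝ) else 0 with hM
  have hM1 : 1 ≤ M := by
    have : (if μ k₁ = m then (1 : ℝ) else 0) ≤ M :=
      Finset.single_le_sum (f := fun k => if μ k = m then (1 : ℝ) else 0)
        (fun k _ => by split_ifs <;> norm_num) (Finset.mem_univ k₁)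
    simpa [hm] using this
  have htend : Tendsto (fun n : ℕ => Real.log (∑ k, u k ^ n)) atTop (𝓝 (Real.log M)) := by
    have h3 := tendsto_sum_pow_mul hu0 hu1 fun _ => 1
    simp only [mul_one, huone] at h3
    exact h3.log (by positivity)
  -- If y < log m, the Gibbs means tend to log m and eventually exceed y; if y > log m, the left
  -- side of `hlog` is unbounded. In the remaining case the uniform distribution on the largest
  -- blocks works.
  have hylog : y = Real.log m := by
    rcases lt_trichotomy y (Real.log m) with h3 | h3 | h3
    · exfalso
      have h4 := tendsto_sum_pow_mul hu0 hu1 fun k => Real.log (μ k) - y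
      have h5 : 0 < ∑ k, if u k = 1 then Real.log (μ k) - y else 0 := by
        refine Finset.sum_pos' (fun k _ => ?_) ⟨k₁, Finset.mem_univ _, ?_⟩
        · split_ifs with h6
          · rw [(huone k).1 h6]; linarith
          · exact le_rfl
        · rw [if_pos ((huone k₁).2 rfl)]; linarith
      obtain ⟨n, hn, hn1⟩ := ((h4.eventually (eventually_gt_nhds h5)).and
        (eventually_ge_atTop 1)).exists
      have h6 := h2 n (by exact_mod_cast hn1)
      have h7 : 0 ≤ (g n - y) * ∑ k, μ k ^ (n : ℝ) := by
        have h8 : (g n - y) * ∑ k, μ k ^ (n : ℝ) = m ^ n * ∑ k, u k ^ n * (Real.log (μ k) - y) := by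
          have h9 : g n * ∑ k, μ k ^ (n : ℝ) = ∑ k, μ k ^ (n : ℝ) * Real.log (μ k) := by
            simp only [hg, Finset.sum_mul]
            refine Finset.sum_congr rfl fun k _ => ?_
            rw [div_mul_eq_mul_div, div_mul_cancel₀ _ (hz n).ne']
          rw [sub_mul, h9, Finset.mul_sum, Finset.mul_sum, ← Finset.sum_sub_distrib]
          refine Finset.sum_congr rfl fun k _ => ?_
          rw [hpow]; ring
        rw [h8]
        positivity
      have := mul_neg_of_neg_of_pos (sub_neg.2 h6) (hz n)
      linarith
    · exact h3
    · exfalso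
      have h4 : Tendsto (fun n : ℕ => x + n * (y - Real.log m)) atTop atTop :=
        tendsto_atTop_add_const_left _ _
          (tendsto_natCast_atTop_atTop.atTop_mul_const (sub_pos.2 h3))
      obtain ⟨n, h5, h6, h7⟩ := ((h4.eventually_gt_atTop (Real.log M + 1)).and
        ((htend.eventually (eventually_lt_nhds (lt_add_one _))).and
          (eventually_ge_atTop 1))).exists
      linarith [hlog n h7]
  have hx : x ≤ Real.log M := by
    refine ge_of_tendsto htend ((eventually_ge_atTop 1).mono fun n hn => ?_)
    have := hlog n hn
    rwa [hylog, sub_self, mul_zero, add_zero] at this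
  have hM0 : 0 < M := by linarith
  have hsum : ∑ k, (if μ k = m then (1 : ℝ) else 0) / M = 1 := by
    rw [← Finset.sum_div, ← hM, div_self hM0.ne']
  have hlogm : ∑ k, (if μ k = m then (1 : ℝ) else 0) / M * Real.log (μ k) = Real.log m := by
    have e : (∑ k, (if μ k = m then (1 : ℝ) else 0) / M) * Real.log m = Real.log m := by
      rw [hsum, one_mul]
    rw [← e, Finset.sum_mul]
    refine Finset.sum_congr rfl fun k _ => ?_
    split_ifs with h3
    · rw [h3]
    · simp
  refine ⟨fun k => (if μ k = m then 1 else 0) / M, fun k => ?_, hsum, fun k hk => ?_,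
    hylog.le.trans hlogm.ge, ?_⟩
  · dsimp only
    split_ifs <;> positivity
  · dsimp only
    rw [if_neg, zero_div]
    rw [hk]; exact hm0.ne
  · have h3 : ∑ k, Real.negMulLog ((if μ k = m then 1 else 0) / M) = Real.log M := by
      have e : (∑ k, (if μ k = m then (1 : ℝ) else 0) / M) * Real.log M = Real.log M := by
        rw [hsum, one_mul]
      rw [← e, Finset.sum_mul]
      refine Finset.sum_congr rfl fun k _ => ?_
      split_ifs with h4
      · rw [Real.negMulLog, Real.log_div one_ne_zero hM0.ne', Real.log_one]; ring
      · simp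
    simp only [h3, hlogm]
    linarith

end Gibbs

/-! ### Entropies and membership in the capacity region. -/

namespace Memory

variable {A B C : Memory}

namespace State

variable (ρ : A.State)

theorem classicalEntropy_eq : ρ.classicalEntropy = ∑ k, Real.negMulLog (ρ.weight k) := by
  simp only [classicalEntropy, Real.negMulLog, neg_mul, Finset.sum_neg_distrib]

theorem eigenvalue_le_weight (k : A.Idx) (j : A.Blk k) : ρ.eigenvalue k j ≤ ρ.weight k :=
  Finset.single_le_sum (fun j _ => ρ.eigenvalue_nonneg k j) (Finset.mem_univ j)

theorem weight_nonneg (k : A.Idx) : 0 ≤ ρ.weight k :=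
  Finset.sum_nonneg fun j _ => ρ.eigenvalue_nonneg k j

theorem weight_le_one (k : A.Idx) : ρ.weight k ≤ 1 := by
  rw [← ρ.sum_weight]
  exact Finset.single_le_sum (fun k _ => ρ.weight_nonneg k) (Finset.mem_univ k)

theorem eigenvalue_mul_log_div (k : A.Idx) (j : A.Blk k) :
    ρ.eigenvalue k j * Real.log (ρ.eigenvalue k j / ρ.weight k) =
      ρ.eigenvalue k j * (Real.log (ρ.eigenvalue k j) - Real.log (ρ.weight k)) := by
  rcases (ρ.eigenvalue_nonneg k j).eq_or_lt with h | h
  · rw [← h, zero_mul, zero_mul]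
  · rw [Real.log_div h.ne' (h.trans_le (ρ.eigenvalue_le_weight k j)).ne']

theorem classicalEntropy_add_quantumEntropy :
    ρ.classicalEntropy + ρ.quantumEntropy = ∑ k, ∑ j, Real.negMulLog (ρ.eigenvalue k j) := by
  rw [classicalEntropy, quantumEntropy, ← neg_add, ← Finset.sum_add_distrib,
    ← Finset.sum_neg_distrib]
  refine Finset.sum_congr rfl fun k _ => ?_
  simp only [ρ.eigenvalue_mul_log_div, mul_sub, Finset.sum_sub_distrib, ← Finset.sum_mul,
    Real.negMulLog, neg_mul, Finset.sum_neg_distrib]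
  rw [show ∑ j, ρ.eigenvalue k j = ρ.weight k from rfl]
  ring

theorem classicalEntropy_nonneg : 0 ≤ ρ.classicalEntropy := by
  rw [classicalEntropy_eq]
  exact Finset.sum_nonneg fun k _ => Real.negMulLog_nonneg (ρ.weight_nonneg k) (ρ.weight_le_one k)

theorem quantumEntropy_nonneg : 0 ≤ ρ.quantumEntropy := by
  rw [quantumEntropy, neg_nonneg]
  refine Finset.sum_nonpos fun k _ => Finset.sum_nonpos fun j _ => ?_
  exact mul_nonpos_of_nonneg_of_nonpos (ρ.eigenvalue_nonneg k j)
    (Real.log_nonpos (div_nonneg (ρ.eigenvalue_nonneg k j) (ρ.weight_nonneg k))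
      (div_le_one_of_le₀ (ρ.eigenvalue_le_weight k j) (ρ.weight_nonneg k)))

end State

/-- The state with given diagonal density matrices. -/
noncomputable def diagState (p : ∀ k, A.Blk k → ℝ) (hp : ∀ k j, 0 ≤ p k j)
    (hs : ∑ k, ∑ j, p k j = 1) : A.State where
  toFun :=
    { toFun := fun a => ∑ k, ∑ j, (p k j : ℂ) * a k j j
      map_add' := fun a b => by
        simp only [Pi.add_apply, Matrix.add_apply, mul_add, Finset.sum_add_distrib]
      map_smul' := fun z a => by
        simp only [Pi.smul_apply, Matrix.smul_apply, smul_eq_mul, Finset.mul_sum, RingHom.id_apply]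
        refine Finset.sum_congr rfl fun k _ => Finset.sum_congr rfl fun j _ => ?_
        ring }
  nonneg := fun a ha => Finset.sum_nonneg fun k _ => Finset.sum_nonneg fun j _ =>
    mul_nonneg (Complex.zero_le_real.2 (hp k j)) (isPos_iff.1 ha k).diag_nonneg
  map_one := by
    change ∑ k, ∑ j, (p k j : ℂ) * (1 : A.Alg) k j j = 1
    simp only [Pi.one_apply, Matrix.one_apply_eq, mul_one]
    exact_mod_cast hs

theorem density_diagState (p : ∀ k, A.Blk k → ℝ) (hp : ∀ k j, 0 ≤ p k j)
    (hs : ∑ k, ∑ j, p k j = 1) (k : A.Idx) :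
    (diagState p hp hs).density k = Matrix.diagonal fun j => (p k j : ℂ) := by
  ext i j
  change ∑ l, ∑ m, (p l m : ℂ) * (A.unit k j i) l m m = _
  rw [Finset.sum_eq_single k]
  · simp only [unit, Pi.single_eq_same]
    by_cases h : i = j
    · subst h
      rw [Finset.sum_eq_single i]
      · simp
      · intro m _ hm
        simp [Ne.symm hm]
      · simp
    · rw [Matrix.diagonal_apply_ne _ h]
      refine Finset.sum_eq_zero fun m _ => ?_
      rw [Matrix.single_apply, if_neg, mul_zero]
      rintro ⟨rfl, rfl⟩
      exact h rfl
  · intro l _ hl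
    simp [unit, Pi.single_eq_of_ne hl]
  · simp

/-- The order in which `eigenvalues` lists the diagonal is not known, so only symmetric sums are
compared, through the roots of the characteristic polynomial. -/
theorem sum_eigenvalue_diagState (p : ∀ k, A.Blk k → ℝ) (hp : ∀ k j, 0 ≤ p k j)
    (hs : ∑ k, ∑ j, p k j = 1) (k : A.Idx) (F : ℝ → ℝ) :
    ∑ j, F ((diagState p hp hs).eigenvalue k j) = ∑ j, F (p k j) := by
  have h1 := ((diagState p hp hs).density_isHermitian k).roots_charpoly_eq_eigenvalues
  have h2 : ((diagState p hp hs).density k).charpoly.roots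
      = Finset.univ.val.map fun j => (p k j : ℂ) := by
    rw [density_diagState, Matrix.charpoly_diagonal]
    have := Polynomial.roots_multiset_prod_X_sub_C (Finset.univ.val.map fun j => (p k j : ℂ))
    rwa [Multiset.map_map] at this
  rw [h2] at h1
  have h3 := congrArg (fun s : Multiset ℂ => (s.map fun z => F z.re).sum) h1
  simp only [Multiset.map_map] at h3
  exact h3.symm

/-- Once the total entropy is right, t = S_σ − y moves the surplus from quantum to classical. -/
theorem mem_capacityRegion (p : ∀ k, B.Blk k → ℝ) (hp : ∀ k j, 0 ≤ p k j)
    (hs : ∑ k, ∑ j, p k j = 1) {x y : ℝ} (hy : 0 ≤ y)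
    (hxy : ∑ k, ∑ j, Real.negMulLog (p k j) = x + y)
    (hH : ∑ k, Real.negMulLog (∑ j, p k j) ≤ x) : (x, y) ∈ B.capacityRegion := by
  set σ := diagState p hp hs with hσ
  have h1 : σ.classicalEntropy = ∑ k, Real.negMulLog (∑ j, p k j) := by
    rw [σ.classicalEntropy_eq]
    refine Finset.sum_congr rfl fun k _ => ?_
    congr 1
    exact sum_eigenvalue_diagState p hp hs k fun z => z
  have h2 : σ.classicalEntropy + σ.quantumEntropy = x + y := by
    rw [σ.classicalEntropy_add_quantumEntropy, ← hxy]
    exact Finset.sum_congr rfl fun k _ => sum_eigenvalue_diagState p hp hs k _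
  refine ⟨σ, σ.quantumEntropy - y, ?_, by linarith, ?_⟩
  · rw [← h1] at hH; linarith
  · rw [Prod.mk.injEq]
    constructor <;> linarith

/-- Uniform distributions in the blocks. -/
theorem mem_capacityRegion_of_weights (r : B.Idx → ℝ) (hr : ∀ k, 0 ≤ r k) (hs : ∑ k, r k = 1)
    (hr0 : ∀ k, (Fintype.card (B.Blk k) : ℝ) = 0 → r k = 0) {x y : ℝ} (hy : 0 ≤ y)
    (hxy : ∑ k, Real.negMulLog (r k) + ∑ k, r k * Real.log (Fintype.card (B.Blk k)) = x + y)
    (hyS : y ≤ ∑ k, r k * Real.log (Fintype.card (B.Blk k))) : (x, y) ∈ B.capacityRegion := by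
  have hsum : ∀ k, ∑ _j : B.Blk k, r k / Fintype.card (B.Blk k) = r k := fun k => by
    rw [Finset.sum_const, Finset.card_univ, nsmul_eq_mul]
    rcases eq_or_ne (Fintype.card (B.Blk k) : ℝ) 0 with h | h
    · rw [h, hr0 k h]; simp
    · field_simp
  refine mem_capacityRegion (fun k _ => r k / Fintype.card (B.Blk k))
    (fun k j => div_nonneg (hr k) (Nat.cast_nonneg _)) (by simp only [hsum, hs]) hy ?_ ?_
  · rw [← hxy, ← Finset.sum_add_distrib]
    refine Finset.sum_congr rfl fun k _ => ?_
    rw [Finset.sum_const, Finset.card_univ, nsmul_eq_mul]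
    rcases eq_or_ne (Fintype.card (B.Blk k) : ℝ) 0 with h | h
    · rw [h, hr0 k h]; simp
    · rcases (hr k).eq_or_lt with h0 | h0
      · rw [← h0]; simp
      · rw [Real.negMulLog, Real.negMulLog, Real.log_div h0.ne' h]
        field_simp
        ring
  · simp only [hsum]
    linarith

/-- `exists_weights` gives at least the total entropy x + y, but the region requires equality. A
path to a state of smaller total entropy and the intermediate value theorem supply it. -/
theorem mem_capacityRegion_of_forall_le (hB : ∃ k, Nonempty (B.Blk k)) {x y : ℝ} (hx : 0 ≤ x)
    (hy : 0 ≤ y) (h : ∀ s : ℝ, 1 ≤ s →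
      x + s * y ≤ Real.log (∑ k, (Fintype.card (B.Blk k) : ℝ) ^ s)) :
    (x, y) ∈ B.capacityRegion := by
  obtain ⟨k₀, hk₀⟩ := hB
  have hk₀' : (0 : ℝ) < Fintype.card (B.Blk k₀) := by exact_mod_cast Fintype.card_pos
  obtain ⟨r, hr, hs, hr0, hyS, hxy⟩ := exists_weights (μ := fun k => (Fintype.card (B.Blk k) : ℝ))
    (fun k => Nat.cast_nonneg _) ⟨k₀, hk₀'⟩ h
  obtain ⟨k₁, -, hk₁⟩ := Finset.exists_max_image Finset.univ
    (fun k => (Fintype.card (B.Blk k) : ℝ)) ⟨k₀, Finset.mem_univ _⟩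
  set m : ℝ := (Fintype.card (B.Blk k₁) : ℝ) with hm
  have hm0 : 0 < m := hk₀'.trans_le (hk₁ k₀ (Finset.mem_univ _))
  have hylog : y ≤ Real.log m := by
    refine hyS.trans ?_
    rw [← one_mul (Real.log m), ← hs, Finset.sum_mul]
    refine Finset.sum_le_sum fun k _ => ?_
    rcases eq_or_ne (Fintype.card (B.Blk k) : ℝ) 0 with h0 | h0
    · rw [hr0 k h0]; simp
    · exact mul_le_mul_of_nonneg_left (Real.log_le_log (lt_of_le_of_ne (Nat.cast_nonneg _)
        (Ne.symm h0)) (hk₁ k (Finset.mem_univ _))) (hr k)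
  rcases le_or_gt (Real.log m) (x + y) with hcase | hcase
  -- The path leads to the uniform state of a largest block, of total entropy log m. The quantum
  -- entropy is affine along it and at least y at both ends.
  · set R : ℝ → B.Idx → ℝ := fun θ k => (1 - θ) * r k + θ * (if k = k₁ then 1 else 0) with hR
    have hRlog : ∀ θ, ∑ k, R θ k * Real.log (Fintype.card (B.Blk k))
        = (1 - θ) * (∑ k, r k * Real.log (Fintype.card (B.Blk k))) + θ * Real.log m := fun θ => by
      simp only [hR, add_mul, Finset.sum_add_distrib, mul_assoc, ← Finset.mul_sum]
      simp [hm]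
    set G : ℝ → ℝ := fun θ => ∑ k, Real.negMulLog (R θ k) +
      ∑ k, R θ k * Real.log (Fintype.card (B.Blk k)) with hG
    have hGc : Continuous G := by
      refine (continuous_finsetSum _ fun k _ => Real.continuous_negMulLog.comp ?_).add
        (continuous_finsetSum _ fun k _ => ?_) <;> fun_prop
    have hG0 : x + y ≤ G 0 := by simpa [hG, hR] using hxy
    have hG1 : G 1 ≤ x + y := by
      refine le_trans (le_of_eq ?_) hcase
      simp only [hG, hRlog]
      have : ∀ k, Real.negMulLog (R 1 k) = 0 := fun k => by
        simp only [hR]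
        split_ifs <;> simp
      simp [this]
    obtain ⟨θ, hθ, hGθ⟩ := intermediate_value_Icc' zero_le_one hGc.continuousOn ⟨hG1, hG0⟩
    refine mem_capacityRegion_of_weights (R θ) (fun k => ?_) ?_ (fun k hk => ?_) hy hGθ ?_
    · have h1 := mul_nonneg (sub_nonneg.2 hθ.2) (hr k)
      have h2 : 0 ≤ θ * (if k = k₁ then (1 : ℝ) else 0) :=
        mul_nonneg hθ.1 (by split_ifs <;> norm_num)
      exact add_nonneg h1 h2
    · simp only [hR, Finset.sum_add_distrib, ← Finset.mul_sum, hs]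
      simp
    · simp only [hR]
      rw [hr0 k hk, if_neg]
      · ring
      · rintro rfl
        exact hm0.ne' hk
    · rw [hRlog]
      nlinarith [hθ.1, hθ.2]
  -- Here one largest block is enough: between its uniform state and a pure state some state has
  -- entropy x + y, and its classical entropy is 0 ≤ x.
  · have hne : Nonempty (B.Blk k₁) := Fintype.card_pos_iff.1 (Nat.cast_pos.1 hm0)
    obtain ⟨j₀⟩ := hne
    set p : ℝ → ∀ k, B.Blk k → ℝ := fun θ => Pi.single k₁ fun j =>
      (1 - θ) / m + θ * (if j = j₀ then 1 else 0) with hp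
    have hsum : ∀ θ, ∑ j, p θ k₁ j = 1 := fun θ => by
      simp only [hp, Pi.single_eq_same, Finset.sum_add_distrib, ← Finset.mul_sum,
        Finset.sum_const, Finset.card_univ, nsmul_eq_mul, ← hm]
      rw [Finset.sum_ite_eq' Finset.univ j₀, if_pos (Finset.mem_univ _)]
      field_simp
      ring
    have hne : ∀ θ k, k ≠ k₁ → p θ k = 0 := fun θ k hk => Pi.single_eq_of_ne hk _
    set G : ℝ → ℝ := fun θ => ∑ j, Real.negMulLog (p θ k₁ j) with hG
    have hGc : Continuous G := by
      refine continuous_finsetSum _ fun j _ => Real.continuous_negMulLog.comp ?_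
      simp only [hp, Pi.single_eq_same]
      fun_prop
    have hG0 : x + y ≤ G 0 := by
      refine hcase.le.trans (le_of_eq ?_)
      simp only [hG, hp, Pi.single_eq_same, zero_mul, add_zero, sub_zero, Finset.sum_const,
        Finset.card_univ, nsmul_eq_mul, ← hm, Real.negMulLog, one_div, Real.log_inv]
      field_simp
    have hG1 : G 1 ≤ x + y := by
      have : G 1 = 0 := by
        refine Finset.sum_eq_zero fun j _ => ?_
        simp only [hp, Pi.single_eq_same]
        split_ifs <;> simp
      linarith
    obtain ⟨θ, hθ, hGθ⟩ := intermediate_value_Icc' zero_le_one hGc.continuousOn ⟨hG1, hG0⟩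
    refine mem_capacityRegion (p θ) (fun k j => ?_) ?_ hy ?_ ?_
    · rcases eq_or_ne k k₁ with rfl | hk
      · simp only [hp, Pi.single_eq_same]
        have h1 : 0 ≤ (1 - θ) / m := div_nonneg (sub_nonneg.2 hθ.2) hm0.le
        have h2 : 0 ≤ θ * (if j = j₀ then (1 : ℝ) else 0) :=
          mul_nonneg hθ.1 (by split_ifs <;> norm_num)
        exact add_nonneg h1 h2
      · rw [hne θ k hk]; exact le_rfl
    · rw [Finset.sum_eq_single k₁, hsum]
      · intro k _ hk
        simp [hne θ k hk]
      · simp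
    · rw [Finset.sum_eq_single k₁]
      · exact hGθ
      · intro k _ hk
        simp [hne θ k hk]
      · simp
    · rw [Finset.sum_eq_single k₁, hsum, Real.negMulLog_one]
      · exact hx
      · intro k _ hk
        simp [hne θ k hk]
      · simp

/-! ### Information content of letters and words. -/

namespace State

variable (ρ : A.State)

/-- The information content of a block. -/
noncomputable def blockInfo (k : A.Idx) (_ : A.Blk k) : ℝ := -Real.log (ρ.weight k)

/-- The information content of an eigenvector within its block. -/
noncomputable def vectorInfo (k : A.Idx) (j : A.Blk k) : ℝ :=
  Real.log (ρ.weight k) - Real.log (ρ.eigenvalue k j)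

theorem sum_blockInfo : ∑ k, ∑ j, ρ.eigenvalue k j * ρ.blockInfo k j = ρ.classicalEntropy := by
  simp only [blockInfo, mul_neg, Finset.sum_neg_distrib, ← Finset.sum_mul, classicalEntropy]
  rfl

theorem sum_vectorInfo : ∑ k, ∑ j, ρ.eigenvalue k j * ρ.vectorInfo k j = ρ.quantumEntropy := by
  rw [quantumEntropy, ← Finset.sum_neg_distrib]
  refine Finset.sum_congr rfl fun k _ => ?_
  rw [← Finset.sum_neg_distrib]
  refine Finset.sum_congr rfl fun j _ => ?_
  rw [ρ.eigenvalue_mul_log_div, vectorInfo]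
  ring

theorem weight_pos {k : A.Idx} {j : A.Blk k} (h : 0 < ρ.eigenvalue k j) : 0 < ρ.weight k :=
  h.trans_le (ρ.eigenvalue_le_weight k j)

theorem blockInfo_nonneg (k : A.Idx) (j : A.Blk k) : 0 ≤ ρ.blockInfo k j :=
  neg_nonneg.2 (Real.log_nonpos (ρ.weight_nonneg k) (ρ.weight_le_one k))

theorem vectorInfo_nonneg (k : A.Idx) (j : A.Blk k) (h : 0 < ρ.eigenvalue k j) :
    0 ≤ ρ.vectorInfo k j :=
  sub_nonneg.2 (Real.log_le_log h (ρ.eigenvalue_le_weight k j))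

theorem prod_weight_eq_exp {N : ℕ} {K : Fin N → A.Idx} {J : ∀ l, A.Blk (K l)}
    (h : ∀ l, 0 < ρ.eigenvalue (K l) (J l)) :
    ∏ l, ρ.weight (K l) = Real.exp (-∑ l, ρ.blockInfo (K l) (J l)) := by
  rw [← Finset.sum_neg_distrib, Real.exp_sum]
  refine Finset.prod_congr rfl fun l _ => ?_
  rw [blockInfo, neg_neg, Real.exp_log (ρ.weight_pos (h l))]

theorem prod_eigenvalue_eq_exp {N : ℕ} {K : Fin N → A.Idx} {J : ∀ l, A.Blk (K l)}
    (h : ∀ l, 0 < ρ.eigenvalue (K l) (J l)) :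
    ∏ l, ρ.eigenvalue (K l) (J l) =
      (∏ l, ρ.weight (K l)) * Real.exp (-∑ l, ρ.vectorInfo (K l) (J l)) := by
  rw [← Finset.sum_neg_distrib, Real.exp_sum, ← Finset.prod_mul_distrib]
  refine Finset.prod_congr rfl fun l _ => ?_
  rw [vectorInfo, neg_sub, Real.exp_sub, Real.exp_log (ρ.weight_pos (h l)), Real.exp_log (h l),
    mul_div_cancel₀ _ (ρ.weight_pos (h l)).ne']

theorem sum_prod_eigenvalue {N : ℕ} (K : Fin N → A.Idx) :
    ∑ J : (∀ l, A.Blk (K l)), ∏ l, ρ.eigenvalue (K l) (J l) = ∏ l, ρ.weight (K l) := by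
  simp only [weight]
  rw [Finset.prod_univ_sum, Fintype.piFinset_univ]

theorem sum_prod_weight (N : ℕ) : ∑ K : Fin N → A.Idx, ∏ l, ρ.weight (K l) = 1 := by
  have := Finset.prod_univ_sum (fun _ : Fin N => (Finset.univ : Finset A.Idx))
    fun _ k => ρ.weight k
  rw [Fintype.piFinset_univ] at this
  rw [← this, ρ.sum_weight, Finset.prod_const_one]

theorem powSpectralForm_w {N : ℕ} (K : Fin N → A.Idx) :
    (ρ.powSpectralForm N).w K = ∏ l, ρ.weight (K l) := ρ.sum_prod_eigenvalue K

theorem prod_weight_nonneg {N : ℕ} (K : Fin N → A.Idx) : 0 ≤ ∏ l, ρ.weight (K l) :=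
  Finset.prod_nonneg fun _ _ => ρ.weight_nonneg _

theorem prod_eigenvalue_nonneg {N : ℕ} (K : Fin N → A.Idx) (J : ∀ l, A.Blk (K l)) :
    0 ≤ ∏ l, ρ.eigenvalue (K l) (J l) :=
  Finset.prod_nonneg fun _ _ => ρ.eigenvalue_nonneg _ _

end State

/-! ### The strong converse. -/

theorem card_pow_blk (B : Memory) {M : ℕ} (L : Fin M → B.Idx) :
    Fintype.card ((B.pow M).Blk L) = ∏ l, Fintype.card (B.Blk (L l)) := Fintype.card_pi

theorem sum_card_pow_rpow (B : Memory) (M : ℕ) (s : ℝ) :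
    ∑ L : (B.pow M).Idx, (Fintype.card ((B.pow M).Blk L) : ℝ) ^ s
      = (∑ k, (Fintype.card (B.Blk k) : ℝ) ^ s) ^ M := by
  have := Finset.prod_univ_sum (fun _ : Fin M => (Finset.univ : Finset B.Idx))
    fun _ k => (Fintype.card (B.Blk k) : ℝ) ^ s
  rw [Fintype.piFinset_univ, Finset.prod_const, Finset.card_univ, Fintype.card_fin] at this
  rw [this]
  refine Finset.sum_congr rfl fun L _ => ?_
  rw [card_pow_blk, Nat.cast_prod, Real.finsetProd_rpow _ _ fun _ _ => Nat.cast_nonneg _]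

/-- Contrapositive of `mem_capacityRegion_of_forall_le`. The bound e^z replaces a logarithm because
the sum is 0 when B has no nonzero block, and `Real.log 0 = 0` would then be misleading; any z < 0
serves in that case. -/
theorem exists_gap {x y : ℝ} (hx : 0 ≤ x) (hy : 0 ≤ y) (h : (x, y) ∉ B.capacityRegion) :
    ∃ s z : ℝ, 1 ≤ s ∧ ∑ k, (Fintype.card (B.Blk k) : ℝ) ^ s ≤ Real.exp z ∧ z < x + s * y := by
  by_cases hB : ∃ k, Nonempty (B.Blk k)
  · by_contra hc
    push Not at hc
    refine h (mem_capacityRegion_of_forall_le hB hx hy fun s hs => ?_)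
    refine hc s _ hs (le_of_eq (Real.exp_log ?_).symm)
    obtain ⟨k, hk⟩ := hB
    exact Finset.sum_pos' (fun k _ => Real.rpow_nonneg (Nat.cast_nonneg _) s)
      ⟨k, Finset.mem_univ _, Real.rpow_pos_of_pos (Nat.cast_pos.2 Fintype.card_pos) s⟩
  · push Not at hB
    refine ⟨1, -1, le_rfl, ?_, by linarith⟩
    have : ∑ k, (Fintype.card (B.Blk k) : ℝ) ^ (1 : ℝ) = 0 :=
      Finset.sum_eq_zero fun k _ => by
        have := hB k
        simp
    rw [this]
    exact (Real.exp_pos _).le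

theorem codeLength_eq {ε : ℚ} {N : ℕ} (h : N ∈ lengths ε) :
    (codeLength ε N : ℝ) = N * (1 + (ε : ℝ)) := by
  have h' : (codeLength ε N : ℚ) = (N : ℚ) * (1 + ε) := h
  exact_mod_cast congrArg (fun q : ℚ => (q : ℝ)) h'

/-- A bound for the number of large blocks in a power of a memory. -/
theorem sum_large_card_le {s z a : ℝ} (hs : 1 ≤ s)
    (hz : ∑ k, (Fintype.card (B.Blk k) : ℝ) ^ s ≤ Real.exp z) (M : ℕ) (ha : 0 < a) :
    ∑ L : (B.pow M).Idx, (if a < Fintype.card ((B.pow M).Blk L) then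
      (Fintype.card ((B.pow M).Blk L) : ℝ) else 0) ≤ Real.exp (z * M) / a ^ (s - 1) := by
  have ha' : 0 < a ^ (s - 1) := Real.rpow_pos_of_pos ha _
  rw [le_div_iff₀ ha', Finset.sum_mul]
  calc _ ≤ ∑ L : (B.pow M).Idx, (Fintype.card ((B.pow M).Blk L) : ℝ) ^ s := by
        refine Finset.sum_le_sum fun L _ => ?_
        split_ifs with h
        · set μ : ℝ := (Fintype.card ((B.pow M).Blk L) : ℝ)
          have hμ : 0 < μ := ha.trans h
          calc μ * a ^ (s - 1) ≤ μ * μ ^ (s - 1) :=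
                mul_le_mul_of_nonneg_left
                  (Real.rpow_le_rpow ha.le h.le (by linarith)) hμ.le
            _ = μ ^ s := by
                rw [← Real.rpow_one_add' hμ.le (by linarith)]
                congr 1; ring
        · rw [zero_mul]
          exact Real.rpow_nonneg (Nat.cast_nonneg _) s
    _ = (∑ k, (Fintype.card (B.Blk k) : ℝ) ^ s) ^ M := sum_card_pow_rpow B M s
    _ ≤ Real.exp z ^ M := pow_le_pow_left₀
        (Finset.sum_nonneg fun k _ => Real.rpow_nonneg (Nat.cast_nonneg _) s) hz M
    _ = Real.exp (z * M) := by rw [← Real.exp_nat_mul]; ring_nf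

/-- The strong converse. -/
theorem exists_completeFidelity_le_exp (ρ : A.State)
    (h : (ρ.classicalEntropy, ρ.quantumEntropy) ∉ B.capacityRegion) :
    ∃ ε₀ : ℚ, 0 < ε₀ ∧ ∃ K c : ℝ, 0 < c ∧
      ∀ ε : ℚ, 0 < ε → ε ≤ ε₀ → ∀ N ∈ lengths ε,
        ∀ (Y : (A.pow N).Alg →ₗ[ℂ] (B.pow (codeLength ε N)).Alg)
          (X : (B.pow (codeLength ε N)).Alg →ₗ[ℂ] (A.pow N).Alg),
          IsDecayOp Y → IsDecayOp X →
            completeFidelity (ρ.pow N) (X ∘ₗ Y) ≤ K * Real.exp (-c * N) := by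
  classical
  obtain ⟨s, z, hs, hz, hgap⟩ :=
    exists_gap ρ.classicalEntropy_nonneg ρ.quantumEntropy_nonneg h
  set x := ρ.classicalEntropy
  set y := ρ.quantumEntropy
  set g := x + s * y - z with hg
  have hg0 : 0 < g := sub_pos.2 hgap
  -- The typicality margins cost 2sδ = g/4 in the exponent and the excess length costs zε ≤ g/4, so
  -- the rate g/2 remains.
  set δ := g / (8 * s) with hδ
  have hδ0 : 0 < δ := by positivity
  have hsδ : s * δ = g / 8 := by rw [hδ]; field_simp
  obtain ⟨c₁, hc₁, h₁⟩ := exists_wordProb_le_exp ρ.eigenvalue_nonneg ρ.sum_eigenvalue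
    ρ.blockInfo (a := x - δ) (by rw [ρ.sum_blockInfo]; linarith)
  obtain ⟨c₂, hc₂, h₂⟩ := exists_wordProb_le_exp ρ.eigenvalue_nonneg ρ.sum_eigenvalue
    ρ.vectorInfo (a := y - δ) (by rw [ρ.sum_vectorInfo]; linarith)
  obtain ⟨ε₀, hε₀, hε₀'⟩ := exists_rat_btwn (show (0 : ℝ) < g / (4 * (|z| + 1)) by positivity)
  have hε₀z : (ε₀ : ℝ) * |z| ≤ g / 4 := by
    rw [lt_div_iff₀ (by positivity)] at hε₀'
    nlinarith [abs_nonneg z]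
  set c := min (min c₁ c₂) (min δ (g / 2)) with hc
  have hc0 : 0 < c := lt_min (lt_min hc₁ hc₂) (lt_min hδ0 (by positivity))
  -- 6 = 4 + 1 + 1: twice the atypical probability, which is at most two exponentials, then κ, then
  -- the large blocks.
  refine ⟨ε₀, by exact_mod_cast hε₀, 6, c, hc0, fun ε hε hεε₀ N hN Y X hY hX => ?_⟩
  have hexp : ∀ b : ℝ, c ≤ b → Real.exp (-b * N) ≤ Real.exp (-c * N) := fun b hb =>
    Real.exp_le_exp.2 (mul_le_mul_of_nonneg_right (neg_le_neg hb) (Nat.cast_nonneg N))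
  set M := codeLength ε N
  set n := Real.exp (N * (x - δ)) with hn
  set d := Real.exp (N * (y - δ)) with hd
  set κ := Real.exp (-δ * N) with hκ
  set T : Finset (Σ K : (A.pow N).Idx, (A.pow N).Blk K) := Finset.univ.filter fun w =>
    ∏ l, ρ.weight (w.1 l) ≤ 1 / n ∧
      ∏ l, ρ.eigenvalue (w.1 l) (w.2 l) ≤ (∏ l, ρ.weight (w.1 l)) / d with hT
  have hF := (ρ.powSpectralForm N).completeFidelity_le_of_typical T (Real.exp_pos _ : 0 < n)
    (Real.exp_pos _ : 0 < d) (Real.exp_pos _ : 0 < κ).le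
    (fun w hw => by rw [ρ.powSpectralForm_w]; exact (Finset.mem_filter.1 hw).2.1)
    (fun w hw => by rw [ρ.powSpectralForm_w]; exact (Finset.mem_filter.1 hw).2.2) hY hX
  have hatyp : (∑ K : (A.pow N).Idx, ∑ J : (A.pow N).Blk K,
      if (⟨K, J⟩ : Σ K : (A.pow N).Idx, (A.pow N).Blk K) ∈ T then 0
        else (ρ.powSpectralForm N).p K J) ≤ Real.exp (-c * N) + Real.exp (-c * N) := by
    refine le_trans ?_ (add_le_add
      ((h₁ N).trans (hexp c₁ ((min_le_left _ _).trans (min_le_left _ _))))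
      ((h₂ N).trans (hexp c₂ ((min_le_left _ _).trans (min_le_right _ _)))))
    refine le_trans (le_of_eq ?_) (wordProb_le_add ρ.eigenvalue_nonneg
      (E := fun K J => ¬ (⟨K, J⟩ : Σ K : (A.pow N).Idx, (A.pow N).Blk K) ∈ T) fun K J hpos hE => ?_)
    · refine Finset.sum_congr rfl fun K _ => Finset.sum_congr rfl fun J _ => ?_
      by_cases hKJ : (⟨K, J⟩ : Σ K : (A.pow N).Idx, (A.pow N).Blk K) ∈ T
      · rw [if_pos hKJ, if_neg fun h => h hKJ]
      · rw [if_neg hKJ, if_pos hKJ]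
        rfl
    · by_contra hcon
      push Not at hcon
      refine hE (Finset.mem_filter.2 ⟨Finset.mem_univ _, ?_, ?_⟩)
      · change ∏ l, ρ.weight (K l) ≤ 1 / n
        rw [ρ.prod_weight_eq_exp hpos, hn, one_div, ← Real.exp_neg]
        exact Real.exp_le_exp.2 (neg_le_neg hcon.1.le)
      · change ∏ l, ρ.eigenvalue (K l) (J l) ≤ (∏ l, ρ.weight (K l)) / d
        rw [ρ.prod_eigenvalue_eq_exp hpos, hd, div_eq_mul_inv, ← Real.exp_neg]
        exact mul_le_mul_of_nonneg_left (Real.exp_le_exp.2 (neg_le_neg hcon.2.le))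
          (ρ.prod_weight_nonneg K)
  have hlarge : 1 / (n * d) * ∑ L : (B.pow M).Idx,
      (if κ * d < Fintype.card ((B.pow M).Blk L) then
        (Fintype.card ((B.pow M).Blk L) : ℝ) else 0) ≤ Real.exp (-c * N) := by
    refine le_trans ?_ (hexp (g / 2) ((min_le_right _ _).trans (min_le_right _ _)))
    have h3 := sum_large_card_le hs hz M
      (show 0 < κ * d from mul_pos (Real.exp_pos _) (Real.exp_pos _))
    refine (mul_le_mul_of_nonneg_left h3 (by positivity)).trans ?_
    have h4 : 1 / (n * d) * (Real.exp (z * M) / (κ * d) ^ (s - 1)) =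
        Real.exp (-(N * (x - δ) + N * (y - δ)) +
          (z * M - (-δ * N + N * (y - δ)) * (s - 1))) := by
      rw [hn, hd, hκ, ← Real.exp_add, ← Real.exp_add, ← Real.exp_mul, one_div, ← Real.exp_neg,
        ← Real.exp_sub, ← Real.exp_add]
    rw [h4]
    refine Real.exp_le_exp.2 ?_
    rw [codeLength_eq hN]
    have h5 : z * (ε : ℝ) ≤ g / 4 := by
      have h6 : (ε : ℝ) ≤ ε₀ := by exact_mod_cast hεε₀
      have h7 : (0 : ℝ) ≤ ε := by exact_mod_cast hε.le
      calc z * (ε : ℝ) ≤ |z| * ε := mul_le_mul_of_nonneg_right (le_abs_self z) h7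
        _ ≤ |z| * ε₀ := mul_le_mul_of_nonneg_left h6 (abs_nonneg z)
        _ ≤ g / 4 := by linarith
    have h8 : -((N : ℝ) * (x - δ) + N * (y - δ)) +
        (z * (N * (1 + (ε : ℝ))) - (-δ * N + N * (y - δ)) * (s - 1))
        = N * (-g + 2 * (s * δ) + z * ε) := by rw [hg]; ring
    rw [h8, hsδ]
    have : (N : ℝ) * (-g + 2 * (g / 8) + z * ε) ≤ N * (-(g / 2)) :=
      mul_le_mul_of_nonneg_left (by linarith) (Nat.cast_nonneg N)
    linarith
  have hκ' := hexp δ ((min_le_right _ _).trans (min_le_left _ _))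
  linarith

/-! ### The direct part: large blocks, typical words, reliable codes. -/

/-- Gibbs' inequality against the uniform distribution of each block: log u ≤ u − 1 with u the ratio
of the uniform weight to the eigenvalue. -/
theorem State.quantumEntropy_le (σ : B.State) : σ.quantumEntropy ≤
    ∑ k, ∑ j, σ.eigenvalue k j * Real.log (Fintype.card (B.Blk k)) := by
  rw [← σ.sum_vectorInfo, ← sub_nonneg, ← Finset.sum_sub_distrib]
  refine Finset.sum_nonneg fun k _ => ?_
  rw [← Finset.sum_sub_distrib]
  have h1 : ∑ j : B.Blk k, (σ.eigenvalue k j - σ.weight k / Fintype.card (B.Blk k)) = 0 := by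
    rw [Finset.sum_sub_distrib, Finset.sum_const, Finset.card_univ, nsmul_eq_mul, sub_eq_zero]
    change σ.weight k = _
    rcases isEmpty_or_nonempty (B.Blk k) with h | h
    · simp [State.weight]
    · field_simp
  rw [← h1]
  refine Finset.sum_le_sum fun j _ => ?_
  have hμ : (0 : ℝ) < Fintype.card (B.Blk k) := Nat.cast_pos.2 (Fintype.card_pos_iff.2 ⟨j⟩)
  rcases (σ.eigenvalue_nonneg k j).eq_or_lt with h | h
  · rw [← h]
    have := div_nonneg (σ.weight_nonneg k) hμ.le
    linarith
  · have hw := σ.weight_pos h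
    have h2 := Real.log_le_sub_one_of_pos
      (div_pos hw (mul_pos h hμ))
    rw [Real.log_div hw.ne' (mul_pos h hμ).ne', Real.log_mul h.ne' hμ.ne'] at h2
    have h3 := mul_le_mul_of_nonneg_left h2 h.le
    have h4 : σ.eigenvalue k j * (σ.weight k / (σ.eigenvalue k j * Fintype.card (B.Blk k)) - 1)
        = σ.weight k / Fintype.card (B.Blk k) - σ.eigenvalue k j := by
      field_simp
    rw [h4] at h3
    rw [State.vectorInfo]
    linarith

/-- Powers of a memory with a state have many large blocks. -/
theorem State.eventually_exists_large_blocks (σ : B.State) {δ : ℝ} (hδ : 0 < δ) :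
    ∀ᶠ M : ℕ in atTop, ∃ G : Finset (B.pow M).Idx,
      1 / 2 * Real.exp (M * (σ.classicalEntropy - δ)) ≤ G.card ∧
      ∀ L ∈ G, Real.exp (M * (σ.quantumEntropy - δ)) ≤ Fintype.card ((B.pow M).Blk L) := by
  classical
  have h1 := tendsto_wordProb_lower σ.eigenvalue_nonneg σ.sum_eigenvalue σ.blockInfo
    -- Next to the block information, the second variable below is log dimension instead of
    -- `vectorInfo`, since dimension is what must be large.
    (a := σ.classicalEntropy - δ) (by rw [σ.sum_blockInfo]; linarith)
  have h2 := tendsto_wordProb_lower σ.eigenvalue_nonneg σ.sum_eigenvalue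
    (fun k _ => Real.log (Fintype.card (B.Blk k))) (a := σ.quantumEntropy - δ)
    (by linarith [σ.quantumEntropy_le])
  have h3 := h1.add h2
  rw [add_zero] at h3
  filter_upwards [h3.eventually (eventually_lt_nhds (show (0 : ℝ) < 1 / 2 by norm_num))] with M hM
  set G : Finset (B.pow M).Idx := Finset.univ.filter fun L =>
    ∏ l, σ.weight (L l) ≤ Real.exp (-(M * (σ.classicalEntropy - δ))) ∧
      Real.exp (M * (σ.quantumEntropy - δ)) ≤ Fintype.card ((B.pow M).Blk L) with hG
  refine ⟨G, ?_, fun L hL => (Finset.mem_filter.1 hL).2.2⟩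
  have h4 : wordProb σ.eigenvalue M (fun L _ => ¬ L ∈ G) ≤ 1 / 2 := by
    refine (wordProb_le_add σ.eigenvalue_nonneg fun L J hpos hL => ?_).trans hM.le
    by_contra hcon
    push Not at hcon
    refine hL (Finset.mem_filter.2 ⟨Finset.mem_univ _, ?_, ?_⟩)
    · rw [σ.prod_weight_eq_exp hpos]
      exact Real.exp_le_exp.2 (neg_le_neg hcon.1.le)
    · rw [card_pow_blk, Nat.cast_prod]
      refine (Real.exp_le_exp.2 hcon.2.le).trans_eq ?_
      rw [Real.exp_sum]
      exact Finset.prod_congr rfl fun l _ =>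
        Real.exp_log (Nat.cast_pos.2 (Fintype.card_pos_iff.2 ⟨J l⟩))
  have h5 := wordProb_add_not σ.sum_eigenvalue (N := M) (fun L _ => L ∈ G)
  -- Blocks of small weight must be numerous to carry probability at least 1/2.
  have h6 : wordProb σ.eigenvalue M (fun L _ => L ∈ G)
      ≤ G.card * Real.exp (-(M * (σ.classicalEntropy - δ))) := by
    have : wordProb σ.eigenvalue M (fun L _ => L ∈ G) = ∑ L ∈ G, ∏ l, σ.weight (L l) := by
      have h0 : wordProb σ.eigenvalue M (fun L _ => L ∈ G)
          = ∑ L : (B.pow M).Idx, if L ∈ G then ∏ l, σ.weight (L l) else 0 := by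
        refine Finset.sum_congr rfl fun L _ => ?_
        by_cases hL : L ∈ G
        · simp [hL, σ.sum_prod_eigenvalue]
        · simp [hL]
      rw [h0, Finset.sum_ite_mem, Finset.univ_inter]
    rw [this, ← nsmul_eq_mul]
    exact Finset.sum_le_card_nsmul _ _ _ fun L hL => (Finset.mem_filter.1 hL).2.1
  have h7 : 1 / 2 ≤ G.card * Real.exp (-(M * (σ.classicalEntropy - δ))) := by linarith
  rw [Real.exp_neg, ← div_eq_mul_inv, le_div_iff₀ (Real.exp_pos _)] at h7
  exact h7

/-- Rounding down a ratio that is at least 1 loses less than a factor 2. -/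
theorem le_two_mul_div {a d : ℕ} (hd : 0 < d) (h : d ≤ a) : (a : ℝ) / (2 * d) ≤ (a / d : ℕ) := by
  rw [div_le_iff₀ (by positivity)]
  have h1 : 1 ≤ a / d := (Nat.one_le_div_iff hd).2 h
  have h2 : a < d * (a / d + 1) := Nat.lt_mul_div_succ a hd
  have h3 : a ≤ (a / d) * (2 * d) := by nlinarith
  exact_mod_cast h3

/-- The typical words of a state. -/
noncomputable def State.typical (ρ : A.State) (N : ℕ) (h s : ℝ) :
    Finset (Σ K : (A.pow N).Idx, (A.pow N).Blk K) :=
  open Classical in Finset.univ.filter fun w =>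
    (∀ l, 0 < ρ.eigenvalue (w.1 l) (w.2 l)) ∧
      ∑ l, ρ.blockInfo (w.1 l) (w.2 l) ≤ N * h ∧ ∑ l, ρ.vectorInfo (w.1 l) (w.2 l) ≤ N * s

theorem State.mem_typical {ρ : A.State} {N : ℕ} {h s : ℝ}
    {w : Σ K : (A.pow N).Idx, (A.pow N).Blk K} : w ∈ ρ.typical N h s ↔
    (∀ l, 0 < ρ.eigenvalue (w.1 l) (w.2 l)) ∧
      ∑ l, ρ.blockInfo (w.1 l) (w.2 l) ≤ N * h ∧ ∑ l, ρ.vectorInfo (w.1 l) (w.2 l) ≤ N * s := by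
  simp [State.typical]

/-- Each typical vector carries at least a fraction e^{−Ns} of the weight of its block. -/
theorem State.card_typical_block_le (ρ : A.State) (N : ℕ) (h s : ℝ) (K : (A.pow N).Idx) :
    (Finset.univ.filter fun J => (⟨K, J⟩ : Σ K : (A.pow N).Idx, (A.pow N).Blk K) ∈
      ρ.typical N h s).card ≤ Real.exp (N * s) := by
  set F := Finset.univ.filter fun J => (⟨K, J⟩ : Σ K : (A.pow N).Idx, (A.pow N).Blk K) ∈
      ρ.typical N h s with hF
  rcases F.eq_empty_or_nonempty with h0 | ⟨J₀, hJ₀⟩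
  · rw [h0, Finset.card_empty, Nat.cast_zero]
    exact (Real.exp_pos _).le
  have hpos := (State.mem_typical.1 (Finset.mem_filter.1 hJ₀).2).1
  set W := ∏ l, ρ.weight (K l) with hW
  have hWpos : 0 < W := Finset.prod_pos fun l _ => ρ.weight_pos (hpos l)
  have h1 : (F.card : ℝ) * (W * Real.exp (-(N * s))) ≤ W := by
    calc (F.card : ℝ) * (W * Real.exp (-(N * s)))
        ≤ ∑ J ∈ F, ∏ l, ρ.eigenvalue (K l) (J l) := by
          rw [← nsmul_eq_mul]
          refine Finset.card_nsmul_le_sum _ _ _ fun J hJ => ?_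
          have hJ' := State.mem_typical.1 (Finset.mem_filter.1 hJ).2
          rw [ρ.prod_eigenvalue_eq_exp hJ'.1]
          exact mul_le_mul_of_nonneg_left (Real.exp_le_exp.2 (neg_le_neg hJ'.2.2)) hWpos.le
      _ ≤ ∑ J : (∀ l, A.Blk (K l)), ∏ l, ρ.eigenvalue (K l) (J l) :=
          Finset.sum_le_sum_of_subset_of_nonneg (Finset.subset_univ _)
            fun J _ _ => ρ.prod_eigenvalue_nonneg K J
      _ = W := ρ.sum_prod_eigenvalue K
  rw [Real.exp_neg, ← div_eq_mul_inv, mul_div_assoc', div_le_iff₀ (Real.exp_pos _),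
    mul_comm] at h1
  exact le_of_mul_le_mul_left h1 hWpos

/-- Each of these blocks has weight at least e^{−Nh}, and the weights sum to 1. -/
theorem State.card_typical_blocks_le (ρ : A.State) (N : ℕ) (h s : ℝ) :
    (((ρ.typical N h s).image Sigma.fst).card : ℝ) ≤ Real.exp (N * h) := by
  have h1 : (((ρ.typical N h s).image Sigma.fst).card : ℝ) * Real.exp (-(N * h)) ≤ 1 := by
    calc _ ≤ ∑ K ∈ (ρ.typical N h s).image Sigma.fst, ∏ l, ρ.weight (K l) := by
          rw [← nsmul_eq_mul]
          refine Finset.card_nsmul_le_sum _ _ _ fun K hK => ?_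
          obtain ⟨w, hw, rfl⟩ := Finset.mem_image.1 hK
          have hw' := State.mem_typical.1 hw
          rw [ρ.prod_weight_eq_exp hw'.1]
          exact Real.exp_le_exp.2 (neg_le_neg hw'.2.1)
      _ ≤ ∑ K : Fin N → A.Idx, ∏ l, ρ.weight (K l) :=
          Finset.sum_le_sum_of_subset_of_nonneg (Finset.subset_univ _)
            fun K _ _ => ρ.prod_weight_nonneg K
      _ = 1 := ρ.sum_prod_weight N
  rwa [Real.exp_neg, ← div_eq_mul_inv, div_le_one (Real.exp_pos _)] at h1

/-- The probability of the atypical words of a state tends to zero. -/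
theorem State.tendsto_atypical (ρ : A.State) {ε : ℝ} (hε : 0 < ε) :
    Tendsto (fun N : ℕ => wordProb ρ.eigenvalue N fun K J =>
      ¬ (⟨K, J⟩ : Σ K : (A.pow N).Idx, (A.pow N).Blk K) ∈
        ρ.typical N (ρ.classicalEntropy * (1 + ε)) (ρ.quantumEntropy * (1 + ε)))
      atTop (𝓝 0) := by
  have h1 := tendsto_wordProb_upper ρ.eigenvalue_nonneg ρ.sum_eigenvalue ρ.blockInfo
    (fun k j _ => ρ.blockInfo_nonneg k j) ρ.sum_blockInfo hε
  have h2 := tendsto_wordProb_upper ρ.eigenvalue_nonneg ρ.sum_eigenvalue ρ.vectorInfo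
    ρ.vectorInfo_nonneg ρ.sum_vectorInfo hε
  have h3 := h1.add h2
  rw [add_zero] at h3
  refine squeeze_zero (fun N => wordProb_nonneg ρ.eigenvalue_nonneg N _) (fun N => ?_) h3
  refine wordProb_le_add ρ.eigenvalue_nonneg fun K J hpos hE => ?_
  by_contra hcon
  push Not at hcon
  exact hE (State.mem_typical.2 ⟨hpos, hcon⟩)

theorem tendsto_codeLength {ε : ℚ} (hε : 0 < ε) : Tendsto (codeLength ε) atTop atTop := by
  refine tendsto_atTop_mono (fun N => ?_) tendsto_id
  refine Nat.le_floor ?_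
  have : (0 : ℚ) ≤ N := Nat.cast_nonneg N
  simp only [id]
  nlinarith

/-- A margin δ that the excess rate can absorb exists only relative to a positive entropy. The cases
S = 0 (slots of dimension one) and H = 0 (a single block to store) need no margin, hence the
conditional form. -/
theorem exists_slack {S H ε : ℝ} (hS : 0 ≤ S) (hH : 0 ≤ H) (hε : 0 < ε) : ∃ δ : ℝ, 0 < δ ∧
    (0 < S → δ * (1 + ε) ≤ S * (ε / 2)) ∧ (0 < H → 2 * δ * (1 + ε) ≤ (H + S) * (ε / 4)) := by
  obtain ⟨v, hv, h1, h2⟩ : ∃ v : ℝ, 0 < v ∧ (0 < S → v ≤ S) ∧ (0 < H → v ≤ H + S) := by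
    rcases hS.eq_or_lt with h | h
    · rcases hH.eq_or_lt with h' | h'
      · exact ⟨1, one_pos, fun h0 => absurd h h0.ne, fun h0 => absurd h' h0.ne⟩
      · exact ⟨H, h', fun h0 => absurd h h0.ne, fun _ => by linarith⟩
    · exact ⟨S, h, fun _ => le_rfl, fun _ => by linarith⟩
  refine ⟨v * ε / (8 * (1 + ε)), by positivity, fun h => ?_, fun h => ?_⟩
  · have : v * ε / (8 * (1 + ε)) * (1 + ε) = v * ε / 8 := by field_simp
    rw [this]
    nlinarith [mul_le_mul_of_nonneg_right (h1 h) hε.le]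
  · have : 2 * (v * ε / (8 * (1 + ε))) * (1 + ε) = v * ε / 4 := by field_simp; norm_num
    rw [this]
    nlinarith [mul_le_mul_of_nonneg_right (h2 h) hε.le]

/-- The typical blocks of a state fit into the memory, if its entropies are in the capacity
region. -/
theorem State.eventually_card_le (ρ : A.State)
    (h : (ρ.classicalEntropy, ρ.quantumEntropy) ∈ B.capacityRegion) {ε : ℚ} (hε : 0 < ε) :
    ∀ᶠ N : ℕ in atTop, N ∈ lengths ε → ∀ m : ℕ,
      (m : ℝ) ≤ Real.exp (N * (ρ.classicalEntropy * (1 + (ε : ℝ) / 2))) →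
      m ≤ ∑ L : (B.pow (codeLength ε N)).Idx, Fintype.card ((B.pow (codeLength ε N)).Blk L) /
        ⌊Real.exp (N * (ρ.quantumEntropy * (1 + (ε : ℝ) / 2)))⌋₊ := by
  obtain ⟨σ, t, ht0, ht1, hσ⟩ := h
  rw [Prod.mk.injEq] at hσ
  obtain ⟨hH, hS⟩ := hσ
  have hHn := ρ.classicalEntropy_nonneg
  have hSn := ρ.quantumEntropy_nonneg
  set H := ρ.classicalEntropy
  set S := ρ.quantumEntropy
  have hεR : (0 : ℝ) < ε := by exact_mod_cast hε
  obtain ⟨δ, hδ, hδS, hδH⟩ := exists_slack hSn hHn hεR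
  have hev := (tendsto_codeLength hε).eventually (σ.eventually_exists_large_blocks hδ)
  have hlog : ∀ᶠ N : ℕ in atTop, 0 < H → Real.log 4 ≤ N * ((H + S) * ((ε : ℝ) / 4)) := by
    by_cases h0 : 0 < H
    · have : Tendsto (fun N : ℕ => (N : ℝ) * ((H + S) * ((ε : ℝ) / 4))) atTop atTop :=
        tendsto_natCast_atTop_atTop.atTop_mul_const (by positivity)
      exact (this.eventually_ge_atTop _).mono fun N hN _ => hN
    · exact Eventually.of_forall fun N h => absurd h h0
  filter_upwards [hev, hlog] with N hG hN hlen m hm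
  have hM := codeLength_eq hlen
  -- M occurs in types, so it is made a variable and only `hM` is kept.
  generalize codeLength ε N = M at hG hM ⊢
  obtain ⟨G, hG1, hG2⟩ := hG
  set d := ⌊Real.exp (N * (S * (1 + (ε : ℝ) / 2)))⌋₊ with hd
  have hN0 : (0 : ℝ) ≤ N := Nat.cast_nonneg N
  have hd0 : 0 < d := Nat.floor_pos.2 (Real.one_le_exp (by positivity))
  have hdle : (d : ℝ) ≤ Real.exp (N * (S * (1 + (ε : ℝ) / 2))) :=
    Nat.floor_le (Real.exp_pos _).le
  have hdcard : ∀ L ∈ G, d ≤ Fintype.card ((B.pow M).Blk L) := by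
    intro L hL
    have h1 := hG2 L hL
    -- If S = 0 then d = 1, and being nonzero is all that is asked of a block.
    rcases hSn.eq_or_lt with h0 | h0
    · have h2 : d = 1 := by rw [hd, ← h0]; simp
      rw [h2]
      exact Nat.one_le_iff_ne_zero.2 fun h3 => by
        rw [h3, Nat.cast_zero] at h1
        exact absurd (Real.exp_pos _) (not_lt.2 h1)
    · have h2 : (d : ℝ) ≤ Fintype.card ((B.pow M).Blk L) := by
        refine hdle.trans (le_trans (Real.exp_le_exp.2 ?_) h1)
        rw [hM, mul_assoc]
        refine mul_le_mul_of_nonneg_left ?_ hN0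
        have := hδS h0
        nlinarith
      exact_mod_cast h2
  have hsum : ∑ L ∈ G, Fintype.card ((B.pow M).Blk L) / d
      ≤ ∑ L : (B.pow M).Idx, Fintype.card ((B.pow M).Blk L) / d :=
    Finset.sum_le_sum_of_subset (Finset.subset_univ G)
  refine le_trans ?_ hsum
  rcases hHn.eq_or_lt with h0 | h0
  · have hm1 : m ≤ 1 := by
      rw [← h0, zero_mul, mul_zero, Real.exp_zero] at hm
      exact_mod_cast hm
    have hG0 : 0 < G.card := by
      have h3 : (0 : ℝ) < G.card := lt_of_lt_of_le
        (mul_pos one_half_pos (Real.exp_pos _)) hG1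
      exact_mod_cast h3
    calc m ≤ G.card := hm1.trans hG0
      _ = ∑ L ∈ G, 1 := by simp
      _ ≤ _ := Finset.sum_le_sum fun L hL => (Nat.one_le_div_iff hd0).2 (hdcard L hL)
  · have hd0' : (0 : ℝ) < d := by exact_mod_cast hd0
    have h1 : (m : ℝ) ≤ ((∑ L ∈ G, Fintype.card ((B.pow M).Blk L) / d : ℕ) : ℝ) := by
      set b := Real.exp (M * (σ.quantumEntropy - δ)) with hb
      set a := Real.exp (M * (σ.classicalEntropy - δ)) with ha
      set e := Real.exp (N * (S * (1 + (ε : ℝ) / 2))) with he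
      calc (m : ℝ) ≤ Real.exp (N * (H * (1 + (ε : ℝ) / 2))) := hm
        _ ≤ 1 / 4 * (a * b / e) := by
            -- One factor 1/2 comes from the count of large blocks, the other from rounding down the
            -- slots. The excess (H + S)ε/2 per letter pays for both: half for 2δ(1 + ε), half for
            -- log 4.
            have h4 : (1 : ℝ) / 4 = Real.exp (-Real.log 4) := by
              rw [Real.exp_neg, Real.exp_log (by norm_num)]; norm_num
            rw [h4, ha, hb, he, ← Real.exp_add, ← Real.exp_sub, ← Real.exp_add]
            refine Real.exp_le_exp.2 ?_
            have h5 : (M : ℝ) * (σ.classicalEntropy - δ) + M * (σ.quantumEntropy - δ)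
                = N * ((H + S) * (1 + ε) - 2 * δ * (1 + ε)) := by
              rw [hM, hH, hS]; ring
            rw [h5]
            have h6 : (N : ℝ) * (2 * δ * (1 + ε)) ≤ N * ((H + S) * ((ε : ℝ) / 4)) :=
              mul_le_mul_of_nonneg_left (hδH h0) hN0
            have h7 := hN h0
            nlinarith
        _ = 1 / 2 * a * (b / (2 * e)) := by ring
        _ ≤ G.card * (b / (2 * d)) := by
            refine mul_le_mul hG1 ?_ (by positivity) (Nat.cast_nonneg _)
            exact div_le_div_of_nonneg_left (Real.exp_pos _).le (by positivity) (by linarith)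
        _ = ∑ L ∈ G, b / (2 * d) := by rw [Finset.sum_const, nsmul_eq_mul]
        _ ≤ ∑ L ∈ G, ((Fintype.card ((B.pow M).Blk L) / d : ℕ) : ℝ) :=
            Finset.sum_le_sum fun L hL => le_trans
              (div_le_div_of_nonneg_right (hG2 L hL) (by positivity))
              (le_two_mul_div hd0 (hdcard L hL))
        _ = _ := by push_cast; rfl
    exact_mod_cast h1

theorem hasReliableCoding (ρ : A.State)
    (h : (ρ.classicalEntropy, ρ.quantumEntropy) ∈ B.capacityRegion) {ε : ℚ} (hε : 0 < ε) :
    HasReliableCoding ρ B ε := by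
  classical
  have hε2 : (0 : ℝ) < (ε : ℝ) / 2 := by
    have : (0 : ℝ) < ε := by exact_mod_cast hε
    linarith
  set η : ℕ → ℝ := fun N => wordProb ρ.eigenvalue N fun K J =>
      ¬ (⟨K, J⟩ : Σ K : (A.pow N).Idx, (A.pow N).Blk K) ∈
        ρ.typical N (ρ.classicalEntropy * (1 + (ε : ℝ) / 2))
          (ρ.quantumEntropy * (1 + (ε : ℝ) / 2)) with hη
  have hη0 : Tendsto η atTop (𝓝 0) := ρ.tendsto_atypical hε2
  have hB : Nonempty B.Idx := by
    obtain ⟨σ, -⟩ := h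
    by_contra hc
    have := σ.sum_eigenvalue
    rw [not_nonempty_iff] at hc
    simp at this
  have hcode : ∀ᶠ N : ℕ in atTop, N ∈ lengths ε →
      ∃ (Y : (A.pow N).Alg →ₗ[ℂ] (B.pow (codeLength ε N)).Alg)
        (X : (B.pow (codeLength ε N)).Alg →ₗ[ℂ] (A.pow N).Alg), IsDecayOp Y ∧ IsDecayOp X ∧
        1 - 2 * Real.sqrt (η N) ≤ completeFidelity (ρ.pow N) (X ∘ₗ Y) := by
    filter_upwards [ρ.eventually_card_le h hε] with N hN hlen
    obtain ⟨f, hf, ⟨β, hβ⟩, hsome⟩ := exists_packing (B := B.pow (codeLength ε N))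
      ⟨fun _ => hB.some⟩
      (ρ.typical N (ρ.classicalEntropy * (1 + (ε : ℝ) / 2))
        (ρ.quantumEntropy * (1 + (ε : ℝ) / 2)))
      ⌊Real.exp (N * (ρ.quantumEntropy * (1 + (ε : ℝ) / 2)))⌋₊
      (fun K => Nat.le_floor (ρ.card_typical_block_le N _ _ K))
      (hN hlen _ (ρ.card_typical_blocks_le N _ _))
    obtain ⟨Y, X, hY, hX, hF⟩ := (ρ.powSpectralForm N).exists_code hf hβ
    refine ⟨Y, X, hY, hX, le_trans (le_of_eq ?_) hF⟩
    congr 3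
    refine Finset.sum_congr rfl fun K _ => Finset.sum_congr rfl fun J _ => ?_
    by_cases hKJ : (⟨K, J⟩ : Σ K : (A.pow N).Idx, (A.pow N).Blk K) ∈
        ρ.typical N (ρ.classicalEntropy * (1 + (ε : ℝ) / 2))
          (ρ.quantumEntropy * (1 + (ε : ℝ) / 2))
    · rw [if_neg fun h => h hKJ, if_pos ((hsome _).2 hKJ)]
    · rw [if_pos hKJ, if_neg fun h => hKJ ((hsome _).1 h)]
      rfl
  -- A code must be named for every N, so the zero maps are used where no good one is available.
  have hall : ∀ N : ℕ, ∃ YX : ((A.pow N).Alg →ₗ[ℂ] (B.pow (codeLength ε N)).Alg) ×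
      ((B.pow (codeLength ε N)).Alg →ₗ[ℂ] (A.pow N).Alg), IsDecayOp YX.1 ∧ IsDecayOp YX.2 ∧
      ((∃ (Y : (A.pow N).Alg →ₗ[ℂ] (B.pow (codeLength ε N)).Alg)
        (X : (B.pow (codeLength ε N)).Alg →ₗ[ℂ] (A.pow N).Alg), IsDecayOp Y ∧ IsDecayOp X ∧
        1 - 2 * Real.sqrt (η N) ≤ completeFidelity (ρ.pow N) (X ∘ₗ Y)) →
        1 - 2 * Real.sqrt (η N) ≤ completeFidelity (ρ.pow N) (YX.2 ∘ₗ YX.1)) := by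
    intro N
    by_cases hex : ∃ (Y : (A.pow N).Alg →ₗ[ℂ] (B.pow (codeLength ε N)).Alg)
        (X : (B.pow (codeLength ε N)).Alg →ₗ[ℂ] (A.pow N).Alg), IsDecayOp Y ∧ IsDecayOp X ∧
        1 - 2 * Real.sqrt (η N) ≤ completeFidelity (ρ.pow N) (X ∘ₗ Y)
    · obtain ⟨Y, X, hY, hX, hF⟩ := hex
      exact ⟨(Y, X), hY, hX, fun _ => hF⟩
    · exact ⟨(0, 0), isDecayOp_zero, isDecayOp_zero, fun h => absurd h hex⟩
  choose YX hYX using hall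
  refine ⟨fun N => (YX N).1, fun N => (YX N).2, fun N _ => ⟨(hYX N).1, (hYX N).2.1⟩, ?_⟩
  have hlow : Tendsto (fun N => 1 - 2 * Real.sqrt (η N)) (atTop ⊓ 𝓟 (lengths ε)) (𝓝 1) := by
    have : Tendsto (fun N => 1 - 2 * Real.sqrt (η N)) atTop (𝓝 (1 - 2 * Real.sqrt 0)) :=
      tendsto_const_nhds.sub (hη0.sqrt.const_mul 2)
    rw [Real.sqrt_zero, mul_zero, sub_zero] at this
    exact this.mono_left inf_le_left
  refine tendsto_of_tendsto_of_tendsto_of_le_of_le' hlow tendsto_const_nhds ?_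
    (Eventually.of_forall fun N =>
      (ρ.powSpectralForm N).completeFidelity_le_one ((hYX N).2.1.comp (hYX N).1))
  rw [eventually_inf_principal]
  exact hcode.mono fun N hN hlen => (hYX N).2.2 (hN hlen)

/-! ### Infinitely many code lengths and the equivalence. -/

/-- Multiples of the denominator of ε are admissible lengths. Without this the limit in reliable
coding would be vacuous and could not contradict the strong converse. -/
theorem neBot_lengths {ε : ℚ} (hε : 0 < ε) : (atTop ⊓ 𝓟 (lengths ε)).NeBot := by
  rw [← frequently_mem_iff_neBot, frequently_atTop]
  intro n
  refine ⟨n * ε.den, Nat.le_mul_of_pos_right n ε.den_pos, ?_⟩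
  have h1 : ((n * ε.den : ℕ) : ℚ) * (1 + ε) = ((n * (ε.den + ε.num.toNat) : ℕ) : ℚ) := by
    have h2 : (ε.den : ℚ) * ε = ε.num := by rw [mul_comm]; exact Rat.mul_den_eq_num ε
    have h3 : ((ε.num.toNat : ℕ) : ℚ) = ε.num := by
      have := Int.toNat_of_nonneg (Rat.num_pos.2 hε).le
      exact_mod_cast congrArg (fun z : ℤ => (z : ℚ)) this
    push_cast
    rw [h3, ← h2]
    ring
  change (⌊((n * ε.den : ℕ) : ℚ) * (1 + ε)⌋₊ : ℚ) = ((n * ε.den : ℕ) : ℚ) * (1 + ε)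
  rw [h1, Nat.floor_natCast]

end Memory

theorem theorem3 (A B : Memory) (ρ : A.State) :
    ((∀ ε : ℚ, 0 < ε → Memory.HasReliableCoding ρ B ε) ↔
      (ρ.classicalEntropy, ρ.quantumEntropy) ∈ B.capacityRegion) ∧
    ((ρ.classicalEntropy, ρ.quantumEntropy) ∉ B.capacityRegion →
      ∃ ε₀ : ℚ, 0 < ε₀ ∧ ∃ K c : ℝ, 0 < c ∧
        ∀ ε : ℚ, 0 < ε → ε ≤ ε₀ → ∀ N ∈ Memory.lengths ε,
          ∀ (Y : (A.pow N).Alg →ₗ[ℂ] (B.pow (Memory.codeLength ε N)).Alg)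
            (X : (B.pow (Memory.codeLength ε N)).Alg →ₗ[ℂ] (A.pow N).Alg),
            Memory.IsDecayOp Y → Memory.IsDecayOp X →
              Memory.completeFidelity (ρ.pow N) (X ∘ₗ Y) ≤ K * Real.exp (-c * N)) := by
  refine ⟨⟨fun h => ?_, fun h ε hε => Memory.hasReliableCoding ρ h hε⟩,
    Memory.exists_completeFidelity_le_exp ρ⟩
  by_contra hC
  obtain ⟨ε, hε, K, c, hc, hbound⟩ := Memory.exists_completeFidelity_le_exp ρ hC
  obtain ⟨Y, X, hYX, hF⟩ := h ε hε
  have := Memory.neBot_lengths hε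
  have h1 : Tendsto (fun N : ℕ => K * Real.exp (-c * N)) (atTop ⊓ 𝓟 (Memory.lengths ε)) (𝓝 0) := by
    have h2 := (tendsto_exp_neg_mul_nat hc).const_mul K
    rw [mul_zero] at h2
    exact h2.mono_left inf_le_left
  have h3 : (1 : ℝ) ≤ 0 := le_of_tendsto_of_tendsto hF h1 (by
    rw [EventuallyLE, eventually_inf_principal]
    exact Eventually.of_forall fun N hN =>
      hbound ε hε le_rfl N hN (Y N) (X N) (hYX N hN).1 (hYX N hN).2)
  linarith
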